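/- Conventions. An order unit space is an archimedean partially ordered real vector space $A$ with a distinguished order unit $1$; its order unit norm is $\|a\|_1=\inf\{\lambda\ge 0:\ -\lambda 1\le a\le \lambda 1\}$, and $E=\{e\in A:\ 0\le e\le 1\}$. A compression with focus $p\in E$ is a positive linear map $J:A\to A$ with $J(1)=p$ such that for all $e\in E$: $e\le p$ implies $J(e)=e$, and $J(e)=0$ implies $e\le 1-p$. A compression base is a family $(J_p)_{p\in P}$ of compressions indexed by their own foci, where $P\subseteq E$ contains $1$, is closed under $p\mapsto 1-p$ and under sums $p+q\le 1$, is normal (if $d,e,f\in E$, $d+e+f\le 1$ and $d+e,\,d+f\in P$, then $d\in P$), and $J_{p+r}\circ J_{q+r}=J_r$ whenever $p,q,r\in P$ and $p+q+r\le 1$. An element $a\in A$ commutes with $p\in P$ if $a=J_p(a)+J_{1-p}(a)$. For $S\subseteq A$ let $PC(S)$ be the set of all $p\in P$ that commute with every element of $S$, and for $a\in A$ let $P(a)=PC(PC(\{a\})\cup\{a\})$. The base is spectral if (a) for every $e\in E$ there is $p\in P$ such that, for all $q\in P$, $e\le q\iff p\le q$, and (b) for every $a\in A$ there is $p\in P(a)$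 with $J_{1-p}(a)\le 0\le J_p(a)$. $A$ is spectral if it has a spectral compression base. The base satisfies the JB condition if $$J_p(q)+J_{1-p}(1-q)=J_q(p)+J_{1-q}(1-p)\qquad\text{for all } p,q\in P.$$ $A$ is a JB-algebra if it is complete in $\|\cdot\|=\|\cdot\|_1$ and has a commutative bilinear product $\circ$ with identity $1$ such that, writing $a^2=a\circ a$, for all $a,b\in A$: $(a^2\circ b)\circ a=a^2\circ(b\circ a)$, $\|a\circ b\|\le\|a\|\|b\|$, $\|a^2\|=\|a\|^2$ and $\|a^2\|\le\|a^2+b^2\|$. It is a JBW-algebra if, moreover, it is isometrically isomorphic to the dual of a Banach space. Theorem 5.4 (generalized spin factors). Let $X$ be a real Banach space with dual $X^*$, and let $A=\mathbb R\times X^*$ be the order unit space with positive cone $A^+=\{(\alpha,y):\ \|y\|\le\alpha\}$ and order unit $(1,0)$. The following are equivalent: 1. $A$ is spectral and satisfies the JB condition, that is, $A$ has a spectral compression base that satisfies the JB condition; 1'. $A$ is spectral, and every spectral compression base of $A$ satisfies the JB condition; 2. $A$ is a JB-algebra; 3. $A$ is a spin factor, that is, $X$ is a Hilbert space (its norm comes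 from an inner product; any dimension is allowed); 4. $A$ is a JBW-algebra. -/

import Mathlib

universe u

/-- An order unit space: an archimedean partially ordered real vector space with a distinguished
order unit. -/
class OrderUnitSpace (A : Type u) [AddCommGroup A] [Module ℝ A] [PartialOrder A] where
  /-- the distinguished order unit -/
  unit : A
  add_le_add_left' : ∀ a b c : A, a ≤ b → c + a ≤ c + b
  smul_nonneg' : ∀ (r : ℝ) (a : A), 0 ≤ r → 0 ≤ a → 0 ≤ r • a
  unit_nonneg : 0 ≤ unit
  exists_le_smul_unit : ∀ a : A, ∃ r : ℝ, 0 ≤ r ∧ a ≤ r • unit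
  archimedean : ∀ a b : A, (∀ n : ℕ, (n : ℝ) • a ≤ b) → a ≤ 0

namespace OrderUnitSpace

section

variable {A : Type u} [AddCommGroup A] [Module ℝ A] [PartialOrder A] [OrderUnitSpace A]

/-! ### The order unit norm -/

/-- The order unit norm `inf {r ≥ 0 | -r • 1 ≤ a ≤ r • 1}`. -/
noncomputable def orderUnitNorm (a : A) : ℝ :=
  sInf {r : ℝ | 0 ≤ r ∧ -(r • (unit : A)) ≤ a ∧ a ≤ r • (unit : A)}

theorem nonneg_sub {a b : A} (h : a ≤ b) : 0 ≤ b - a := by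
  have := add_le_add_left' a b (-a) h
  simpa [neg_add_eq_sub] using this

theorem le_of_nonneg_sub {a b : A} (h : 0 ≤ b - a) : a ≤ b := by
  have := add_le_add_left' 0 (b - a) a h
  simpa using this

theorem add_le_add' {a b c d : A} (h : a ≤ b) (h' : c ≤ d) : a + c ≤ b + d := by
  have h1 := add_le_add_left' c d a h'
  have h2 := add_le_add_left' a b d h
  rw [add_comm d a, add_comm d b] at h2
  exact h1.trans h2

theorem neg_le_neg'' {a b : A} (h : a ≤ b) : -b ≤ -a := by
  apply le_of_nonneg_sub
  have := nonneg_sub h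
  rwa [neg_sub_neg]

theorem smul_le_smul' {a b : A} {r : ℝ} (hr : 0 ≤ r) (h : a ≤ b) : r • a ≤ r • b := by
  apply le_of_nonneg_sub
  rw [← smul_sub]
  exact smul_nonneg' _ _ hr (nonneg_sub h)

theorem smul_unit_mono {r s : ℝ} (h : r ≤ s) : r • (unit : A) ≤ s • (unit : A) := by
  apply le_of_nonneg_sub
  rw [← sub_smul]
  exact smul_nonneg' _ _ (sub_nonneg.2 h) unit_nonneg

theorem exists_bound (a : A) :
    ∃ r : ℝ, 0 ≤ r ∧ -(r • (unit : A)) ≤ a ∧ a ≤ r • (unit : A) := by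
  obtain ⟨r, hr, h⟩ := exists_le_smul_unit a
  obtain ⟨s, hs, h'⟩ := exists_le_smul_unit (-a)
  refine ⟨max r s, le_max_of_le_left hr, ?_, h.trans (smul_unit_mono (le_max_left r s))⟩
  have := neg_le_neg'' (h'.trans (smul_unit_mono (le_max_right r s)))
  rwa [neg_neg] at this

theorem orderUnitNorm_nonneg (a : A) : 0 ≤ orderUnitNorm a :=
  Real.sInf_nonneg fun _ hr => hr.1

theorem orderUnitNorm_le {a : A} {r : ℝ} (hr : 0 ≤ r) (h : -(r • (unit : A)) ≤ a)
    (h' : a ≤ r • (unit : A)) : orderUnitNorm a ≤ r :=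
  csInf_le ⟨0, fun _ hr => hr.1⟩ ⟨hr, h, h'⟩

theorem bound_of_orderUnitNorm_lt {a : A} {r : ℝ} (h : orderUnitNorm a < r) :
    -(r • (unit : A)) ≤ a ∧ a ≤ r • (unit : A) := by
  obtain ⟨s, ⟨_, h1, h2⟩, hs⟩ := exists_lt_of_csInf_lt (exists_bound a) h
  have := smul_unit_mono (A := A) hs.le
  exact ⟨(neg_le_neg'' this).trans h1, h2.trans this⟩

theorem le_zero_of_forall_le {a : A} (h : ∀ r : ℝ, 0 < r → a ≤ r • (unit : A)) : a ≤ 0 := by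
  apply archimedean a unit
  intro n
  rcases Nat.eq_zero_or_pos n with rfl | hn
  · simpa using (unit_nonneg : (0 : A) ≤ unit)
  · have hn' : (0 : ℝ) < n := by exact_mod_cast hn
    have := smul_le_smul' hn'.le (h (n : ℝ)⁻¹ (inv_pos.2 hn'))
    rwa [smul_smul, mul_inv_cancel₀ hn'.ne', one_smul] at this

theorem orderUnitNorm_neg_le (a : A) : orderUnitNorm (-a) ≤ orderUnitNorm a := by
  refine le_of_forall_gt fun r hr => ?_
  obtain ⟨s, hs, hsr⟩ := exists_between hr
  obtain ⟨h1, h2⟩ := bound_of_orderUnitNorm_lt hs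
  refine (orderUnitNorm_le ((orderUnitNorm_nonneg a).trans hs.le) (neg_le_neg'' h2) ?_).trans_lt hsr
  have := neg_le_neg'' h1
  rwa [neg_neg] at this

theorem orderUnitNorm_smul_le (t : ℝ) (a : A) :
    orderUnitNorm (t • a) ≤ |t| * orderUnitNorm a := by
  wlog ht : 0 ≤ t generalizing t a
  · have := this (-t) (-a) (by linarith [not_le.1 ht])
    rw [neg_smul_neg, abs_neg] at this
    exact this.trans (mul_le_mul_of_nonneg_left (orderUnitNorm_neg_le a) (abs_nonneg t))
  rw [abs_of_nonneg ht]
  refine le_of_forall_pos_le_add fun ε hε => ?_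
  have hδ : 0 < ε / (t + 1) := by positivity
  obtain ⟨h1, h2⟩ := bound_of_orderUnitNorm_lt (lt_add_of_pos_right (orderUnitNorm a) hδ)
  have h0 := orderUnitNorm_nonneg a
  refine (orderUnitNorm_le (r := t * (orderUnitNorm a + ε / (t + 1))) (by positivity) ?_ ?_).trans ?_
  · rw [mul_smul, ← smul_neg]
    exact smul_le_smul' ht h1
  · rw [mul_smul]
    exact smul_le_smul' ht h2
  · rw [mul_add]
    have : t * (ε / (t + 1)) ≤ ε := by
      rw [mul_div_assoc', div_le_iff₀ (by positivity)]
      nlinarith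
    linarith

variable (A) in
/-- The order unit norm as a norm on the additive group of the space. -/
noncomputable def addGroupNorm : AddGroupNorm A where
  toFun := orderUnitNorm
  map_zero' := le_antisymm
    (orderUnitNorm_le le_rfl (by simp) (by simp)) (orderUnitNorm_nonneg 0)
  add_le' a b := by
    refine le_of_forall_pos_le_add fun ε hε => ?_
    obtain ⟨h1, h2⟩ := bound_of_orderUnitNorm_lt (lt_add_of_pos_right (orderUnitNorm a) (half_pos hε))
    obtain ⟨h3, h4⟩ := bound_of_orderUnitNorm_lt (lt_add_of_pos_right (orderUnitNorm b) (half_pos hε))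
    have ha := orderUnitNorm_nonneg a
    have hb := orderUnitNorm_nonneg b
    have e : orderUnitNorm a + orderUnitNorm b + ε
        = (orderUnitNorm a + ε / 2) + (orderUnitNorm b + ε / 2) := by ring
    rw [e]
    refine orderUnitNorm_le (by positivity) ?_ ?_
    · rw [add_smul, neg_add]
      exact add_le_add' h1 h3
    · rw [add_smul]
      exact add_le_add' h2 h4
  neg' a := le_antisymm (orderUnitNorm_neg_le a)
    (by simpa using orderUnitNorm_neg_le (-a))
  eq_zero_of_map_eq_zero' a h := by
    have h' : ∀ r : ℝ, 0 < r → -(r • (unit : A)) ≤ a ∧ a ≤ r • (unit : A) := fun r hr =>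
      bound_of_orderUnitNorm_lt (h.trans_lt hr)
    refine le_antisymm (le_zero_of_forall_le fun r hr => (h' r hr).2) ?_
    have : -a ≤ 0 := le_zero_of_forall_le fun r hr => by
      have := neg_le_neg'' (h' r hr).1
      rwa [neg_neg] at this
    have := neg_le_neg'' this
    simpa using this

/-! ### Compressions and compression bases -/

/-- A compression with focus `p`: a positive linear map `J` with `J 1 = p ∈ [0, 1]` such that, for
all effects `e`, `e ≤ p` implies `J e = e`, and `J e = 0` implies `e ≤ 1 - p`. -/
structure IsCompression (p : A) (J : A →ₗ[ℝ] A) : Prop where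
  positive : ∀ a, 0 ≤ a → 0 ≤ J a
  map_unit : J unit = p
  focus_mem : p ∈ Set.Icc (0 : A) unit
  map_eq_self : ∀ e ∈ Set.Icc (0 : A) unit, e ≤ p → J e = e
  le_of_map_eq_zero : ∀ e ∈ Set.Icc (0 : A) unit, J e = 0 → e ≤ unit - p

variable (A) in
/-- A compression base: a family of compressions indexed by their own foci, where the set `P` of
foci is a normal subalgebra of the effect algebra `[0, 1]`, and `J_{p+r} ∘ J_{q+r} = J_r` whenever
`p, q, r ∈ P` and `p + q + r ≤ 1`. (The values of `J` outside `P` play no role.) -/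
structure CompressionBase where
  /-- the set of projections -/
  P : Set A
  /-- the compression with a given focus -/
  J : A → A →ₗ[ℝ] A
  isCompression : ∀ p ∈ P, IsCompression p (J p)
  unit_mem : unit ∈ P
  compl_mem : ∀ p ∈ P, unit - p ∈ P
  add_mem : ∀ p ∈ P, ∀ q ∈ P, p + q ≤ unit → p + q ∈ P
  normal : ∀ d ∈ Set.Icc (0 : A) unit, ∀ e ∈ Set.Icc (0 : A) unit, ∀ f ∈ Set.Icc (0 : A) unit,
    d + e + f ≤ unit → d + e ∈ P → d + f ∈ P → d ∈ P
  comp : ∀ p ∈ P, ∀ q ∈ P, ∀ r ∈ P, p + q + r ≤ unit → J (p + r) ∘ₗ J (q + r) = J r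

namespace CompressionBase

variable (B : CompressionBase A)

/-- `a` commutes with the projection `p`, i.e. `a ∈ C(p)`. -/
def Commutes (a p : A) : Prop := a = B.J p a + B.J (unit - p) a

/-- `PC(S)`: the set of projections commuting with all elements of `S`. -/
def PC (S : Set A) : Set A := {p | p ∈ B.P ∧ ∀ a ∈ S, B.Commutes a p}

/-- The P-bicommutant `P(a) = PC(PC(a) ∪ {a})`. -/
def bicommutant (a : A) : Set A := B.PC (B.PC {a} ∪ {a})

/-- Every effect has a projection cover. -/
def HasProjectionCover : Prop :=
  ∀ e ∈ Set.Icc (0 : A) unit, ∃ p ∈ B.P, ∀ q ∈ B.P, e ≤ q ↔ p ≤ q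

/-- The comparability property. -/
def HasComparability : Prop :=
  ∀ a : A, ∃ p ∈ B.bicommutant a, B.J (unit - p) a ≤ 0 ∧ 0 ≤ B.J p a

/-- A compression base is spectral if it has both the projection cover and the comparability
property. -/
def IsSpectral : Prop := B.HasProjectionCover ∧ B.HasComparability

/-- The JB condition: `J_p(q) + J_{1-p}(1-q) = J_q(p) + J_{1-q}(1-p)` for all projections. -/
def JBCondition : Prop :=
  ∀ p ∈ B.P, ∀ q ∈ B.P,
    B.J p q + B.J (unit - p) (unit - q) = B.J q p + B.J (unit - q) (unit - p)

end CompressionBase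

end

end OrderUnitSpace

/-! ### JB-algebras and JBW-algebras -/

/-- The bilinear product `mul` on the normed space `A` is a Jordan product with identity `one`
which satisfies the norm axioms of a JB-algebra. -/
structure IsJBProduct {A : Type u} [NormedAddCommGroup A] [NormedSpace ℝ A]
    (one : A) (mul : A →ₗ[ℝ] A →ₗ[ℝ] A) : Prop where
  comm : ∀ a b, mul a b = mul b a
  jordan : ∀ a b, mul (mul (mul a a) b) a = mul (mul a a) (mul b a)
  one_mul : ∀ a, mul one a = a
  norm_mul_le : ∀ a b, ‖mul a b‖ ≤ ‖a‖ * ‖b‖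
  norm_sq : ∀ a, ‖mul a a‖ = ‖a‖ ^ 2
  norm_sq_le : ∀ a b, ‖mul a a‖ ≤ ‖mul a a + mul b b‖

/-- `A`, with its given norm, is complete and carries a Jordan product with identity `one` which
makes it a JB-algebra. -/
def IsJBAlgebra (A : Type u) [NormedAddCommGroup A] [NormedSpace ℝ A] (one : A) : Prop :=
  CompleteSpace A ∧ ∃ mul : A →ₗ[ℝ] A →ₗ[ℝ] A, IsJBProduct one mul

/-- A JBW-algebra: a JB-algebra that is (isometrically isomorphic to) the dual of a Banach
space. -/
def IsJBWAlgebra (A : Type u) [NormedAddCommGroup A] [NormedSpace ℝ A] (one : A) : Prop :=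
  IsJBAlgebra A one ∧
    ∃ (Y : Type u) (_ : NormedAddCommGroup Y) (_ : NormedSpace ℝ Y) (_ : CompleteSpace Y),
      Nonempty (A ≃ₗᵢ[ℝ] StrongDual ℝ Y)

/-! ### Generalized spin factors -/

section

variable (X : Type u) [NormedAddCommGroup X] [NormedSpace ℝ X]

/-- The vector space `ℝ × X*` underlying the generalized spin factor of `X`. It is a type synonym,
so that it carries neither the componentwise order nor the supremum norm of the product. -/
def GenSpinFactor : Type u := ℝ × StrongDual ℝ X

namespace GenSpinFactor

noncomputable instance : AddCommGroup (GenSpinFactor X) :=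
  inferInstanceAs (AddCommGroup (ℝ × StrongDual ℝ X))

noncomputable instance : Module ℝ (GenSpinFactor X) :=
  inferInstanceAs (Module ℝ (ℝ × StrongDual ℝ X))

/-- The order given by the positive cone `{(α, y) | ‖y‖ ≤ α}`: `a ≤ b` means that `b - a` lies in
the cone. -/
instance : PartialOrder (GenSpinFactor X) where
  le a b := ‖(b - a).2‖ ≤ (b - a).1
  le_refl a := by
    rw [sub_self]
    exact (norm_zero (E := StrongDual ℝ X)).le
  le_trans a b c h h' := by
    have e : c - a = (c - b) + (b - a) := (sub_add_sub_cancel c b a).symm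
    change ‖(c - a).2‖ ≤ (c - a).1
    rw [e]
    exact (norm_add_le (E := StrongDual ℝ X) _ _).trans (add_le_add h' h)
  le_antisymm a b h h' := by
    have e : a - b = -(b - a) := (neg_sub b a).symm
    change ‖(a - b).2‖ ≤ (a - b).1 at h'
    change ‖(b - a).2‖ ≤ (b - a).1 at h
    rw [e] at h'
    have h1 : ‖(b - a).2‖ ≤ -(b - a).1 := by
      have := norm_neg (E := StrongDual ℝ X) (b - a).2
      exact this.ge.trans h'
    have h0 : 0 ≤ ‖(b - a).2‖ := norm_nonneg (E := StrongDual ℝ X) _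
    have h2 : (b - a).2 = 0 := norm_le_zero_iff.1 (by linarith)
    have h3 : (b - a).1 = 0 := by linarith
    have : b - a = 0 := Prod.ext h3 h2
    exact (sub_eq_zero.1 this).symm

variable {X} in
theorem le_def (a b : GenSpinFactor X) : a ≤ b ↔ ‖b.2 - a.2‖ ≤ b.1 - a.1 := Iff.rfl

variable {X} in
theorem nonneg_iff (a : GenSpinFactor X) : 0 ≤ a ↔ ‖a.2‖ ≤ a.1 := by
  have : a - 0 = a := sub_zero a
  change ‖(a - 0).2‖ ≤ (a - 0).1 ↔ _
  rw [this]

/-- `ℝ × X*` is an order unit space with order unit `(1, 0)`. -/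
noncomputable instance : OrderUnitSpace (GenSpinFactor X) where
  unit := ((1, 0) : ℝ × StrongDual ℝ X)
  add_le_add_left' a b c h := by
    change ‖((c + b) - (c + a)).2‖ ≤ ((c + b) - (c + a)).1
    rw [add_sub_add_left_eq_sub]
    exact h
  smul_nonneg' r a hr h := by
    rw [nonneg_iff] at h ⊢
    change ‖r • a.2‖ ≤ r * a.1
    rw [norm_smul, Real.norm_of_nonneg hr]
    exact mul_le_mul_of_nonneg_left h hr
  unit_nonneg := by
    refine (nonneg_iff _).2 ?_
    exact (norm_zero (E := StrongDual ℝ X)).le.trans zero_le_one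
  exists_le_smul_unit a := by
    refine ⟨|a.1| + ‖a.2‖, by positivity, ?_⟩
    rw [le_def]
    change ‖(|a.1| + ‖a.2‖) • (0 : StrongDual ℝ X) - a.2‖ ≤ (|a.1| + ‖a.2‖) * 1 - a.1
    rw [smul_zero, zero_sub, norm_neg]
    linarith [le_abs_self a.1]
  archimedean a b h := by
    rw [le_def]
    change ‖(0 : StrongDual ℝ X) - a.2‖ ≤ 0 - a.1
    rw [zero_sub, zero_sub, norm_neg]
    by_contra! hlt
    obtain ⟨n, hn⟩ := exists_nat_gt ((‖b.2‖ + b.1) / (‖a.2‖ + a.1))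
    have hpos : 0 < ‖a.2‖ + a.1 := by linarith
    rw [div_lt_iff₀ hpos] at hn
    have h1 : ‖b.2 - (n : ℝ) • a.2‖ ≤ b.1 - n * a.1 := h n
    have h2 : ‖(n : ℝ) • a.2‖ ≤ ‖b.2‖ + ‖b.2 - (n : ℝ) • a.2‖ := norm_le_norm_add_norm_sub _ _
    rw [norm_smul, Real.norm_of_nonneg (Nat.cast_nonneg n)] at h2
    linarith

/-- The norm of a generalized spin factor is its order unit norm. -/
noncomputable instance : NormedAddCommGroup (GenSpinFactor X) :=
  (OrderUnitSpace.addGroupNorm (GenSpinFactor X)).toNormedAddCommGroup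

noncomputable instance : NormedSpace ℝ (GenSpinFactor X) where
  norm_smul_le t a := OrderUnitSpace.orderUnitNorm_smul_le t a

end GenSpinFactor

/-- The norm of `X` comes from an inner product (on the given real vector space). For a Banach
space `X` this says that `X` is a Hilbert space, i.e. that `ℝ × X*` is a spin factor. -/
def IsSpinFactor : Prop :=
  ∃ ip : InnerProductSpace ℝ X, ip.toNormedSpace = ‹NormedSpace ℝ X›

end

/-!
Each of the conditions is equivalent to the parallelogram law for the norm of `X*`, which passes to
`X` and back by duality.

The nontrivial foci of compressions of `ℝ × X*` are the elements `(1/2, u/2)` with `‖u‖ = 1`; by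
comparability all of them lie in `P`, and `J_p` maps onto the line through its focus `p`. Hence
`J_p` amounts to a support functional `σ u` of the unit ball at `u`, and the JB condition says that
`(σ u - σ (-u)) / 2` is symmetric in `u` and its argument, so that it extends to an inner product on
`X*`. Likewise, in a JB-algebra the scalar part of `y ∘ y` is `‖y‖²`, because squares are positive.

Conversely, if `X*` is an inner product space, then support functionals are unique, so `J_p` can
only be the quadratic representation `U_p` of the spin product, and for idempotents
`U_p q + U_{1-p} (1-q) = p ∘ q + (1-p) ∘ (1-q)` is symmetric in `p` and `q`. Finally, `ℝ × X*` is
the dual of the completion of `ℝ × X` with the supremum norm, so every JB-algebra of this form is a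
JBW-algebra.
-/

/-! ### The parallelogram law and duality -/

section Parallelogram

variable {V : Type*} [NormedAddCommGroup V] [NormedSpace ℝ V]

theorem isSpinFactor_iff_innerProductSpaceable {X : Type u} [NormedAddCommGroup X]
    [NormedSpace ℝ X] : IsSpinFactor X ↔ InnerProductSpaceable X := by
  refine ⟨?_, fun h => ⟨InnerProductSpace.ofNorm ℝ h.parallelogram_identity, rfl⟩⟩
  rintro ⟨_, -⟩
  infer_instance

theorem innerProductSpaceable_of_le
    (h : ∀ x y : V, ‖x + y‖ ^ 2 + ‖x - y‖ ^ 2 ≤ 2 * (‖x‖ ^ 2 + ‖y‖ ^ 2)) :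
    InnerProductSpaceable V := by
  refine ⟨fun x y => ?_⟩
  -- The reverse inequality is `h` for the pair `x + y`, `x - y`.
  have h' := h (x + y) (x - y)
  rw [add_add_sub_cancel, add_sub_sub_cancel, ← two_smul ℝ x, ← two_smul ℝ y, norm_smul, norm_smul,
    Real.norm_two] at h'
  linarith [h x y]

theorem innerProductSpaceable_of_symm (b : V → V →ₗ[ℝ] ℝ) (symm : ∀ x y, b x y = b y x)
    (self : ∀ x, b x x = ‖x‖ ^ 2) : InnerProductSpaceable V := by
  refine innerProductSpaceable_of_le fun x y => le_of_eq ?_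
  simp only [← self, map_add, map_sub, symm (x + y), symm (x - y)]
  ring

theorem innerProductSpaceable_of_symm_on_sphere (b : V → V →ₗ[ℝ] ℝ)
    (symm : ∀ u v, ‖u‖ = 1 → ‖v‖ = 1 → b u v = b v u) (self : ∀ u, ‖u‖ = 1 → b u u = 1) :
    InnerProductSpaceable V := by
  have unit_norm {x : V} (hx : x ≠ 0) : ‖‖x‖⁻¹ • x‖ = 1 := norm_smul_inv_norm (𝕜 := ℝ) hx
  have scale {x : V} (hx : x ≠ 0) (z : V) : b z x = ‖x‖ * b z (‖x‖⁻¹ • x) := by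
    rw [map_smul, smul_eq_mul, mul_inv_cancel_left₀ (norm_ne_zero_iff.2 hx)]
  -- The homogeneous extension of `b` to all of `V`.
  refine innerProductSpaceable_of_symm (fun x => ‖x‖ • b (‖x‖⁻¹ • x)) (fun x y => ?_) fun x => ?_
  · rcases eq_or_ne x 0 with rfl | hx
    · simp
    rcases eq_or_ne y 0 with rfl | hy
    · simp
    calc ‖x‖ * b (‖x‖⁻¹ • x) y
        = ‖x‖ * (‖y‖ * b (‖x‖⁻¹ • x) (‖y‖⁻¹ • y)) := by rw [← scale hy]
      _ = ‖y‖ * (‖x‖ * b (‖y‖⁻¹ • y) (‖x‖⁻¹ • x)) := by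
        rw [symm _ _ (unit_norm hx) (unit_norm hy), mul_left_comm]
      _ = ‖y‖ * b (‖y‖⁻¹ • y) x := by rw [← scale hx]
  · rcases eq_or_ne x 0 with rfl | hx
    · simp
    calc ‖x‖ * b (‖x‖⁻¹ • x) x
        = ‖x‖ * (‖x‖ * b (‖x‖⁻¹ • x) (‖x‖⁻¹ • x)) := by rw [← scale hx]
      _ = ‖x‖ ^ 2 := by rw [self _ (unit_norm hx), mul_one, sq]

theorem norm_sq_le_of_forall_apply_le {f : StrongDual ℝ V} {c : ℝ} (h : ∀ x, f x ≤ ‖x‖ ^ 2 + c) :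
    ‖f‖ ^ 2 ≤ 4 * c := by
  have hc : 0 ≤ c := by simpa using h 0
  have hf : ‖f‖ ≤ 2 * √c := by
    refine f.opNorm_le_bound (by positivity) fun x => ?_
    have hdiscr : discrim (‖x‖ ^ 2) (-f x) c ≤ 0 := by
      refine discrim_le_zero fun t => ?_
      have := h (t • x)
      rw [map_smul, norm_smul, mul_pow, Real.norm_eq_abs, sq_abs, smul_eq_mul] at this
      linarith
    rw [Real.norm_eq_abs]
    refine abs_le_of_sq_le_sq ?_ (by positivity)
    rw [discrim] at hdiscr
    rw [mul_pow, mul_pow, Real.sq_sqrt hc]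
    linarith
  calc ‖f‖ ^ 2 ≤ (2 * √c) ^ 2 := by gcongr
    _ = 4 * c := by rw [mul_pow, Real.sq_sqrt hc]; ring

instance innerProductSpaceable_strongDual [InnerProductSpaceable V] :
    InnerProductSpaceable (StrongDual ℝ V) := by
  refine innerProductSpaceable_of_le fun f g => ?_
  have key (x w : V) : (f + g) x + (f - g) w ≤ ‖x‖ ^ 2 + ‖w‖ ^ 2 + (‖f‖ ^ 2 + ‖g‖ ^ 2) / 2 := by
    have hf : f (x + w) ≤ ‖f‖ * ‖x + w‖ := (le_abs_self _).trans (f.le_opNorm _)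
    have hg : g (x - w) ≤ ‖g‖ * ‖x - w‖ := (le_abs_self _).trans (g.le_opNorm _)
    have hp := InnerProductSpaceable.parallelogram_identity x w
    rw [map_add] at hf
    rw [map_sub] at hg
    rw [add_apply, sub_apply]
    nlinarith [sq_nonneg (‖f‖ - ‖x + w‖), sq_nonneg (‖g‖ - ‖x - w‖)]
  have hadd (w : V) :
      ‖f + g‖ ^ 2 ≤ 4 * (‖w‖ ^ 2 + (‖f‖ ^ 2 + ‖g‖ ^ 2) / 2 - (f - g) w) :=
    norm_sq_le_of_forall_apply_le fun x => by linarith [key x w]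
  have hsub : ‖f - g‖ ^ 2 ≤ 4 * ((‖f‖ ^ 2 + ‖g‖ ^ 2) / 2 - ‖f + g‖ ^ 2 / 4) :=
    norm_sq_le_of_forall_apply_le fun w => by linarith [hadd w]
  linarith

theorem innerProductSpaceable_of_linearIsometry {W : Type*} [NormedAddCommGroup W]
    [NormedSpace ℝ W] [InnerProductSpaceable W] (φ : V →ₗᵢ[ℝ] W) : InnerProductSpaceable V :=
  ⟨fun x y => by
    simpa only [← map_add, ← map_sub, φ.norm_map] using
      InnerProductSpaceable.parallelogram_identity (φ x) (φ y)⟩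

theorem innerProductSpaceable_strongDual_iff :
    InnerProductSpaceable (StrongDual ℝ V) ↔ InnerProductSpaceable V :=
  ⟨fun _ => innerProductSpaceable_of_linearIsometry (W := StrongDual ℝ (StrongDual ℝ V))
    (NormedSpace.inclusionInDoubleDualLi ℝ),
    fun _ => inferInstance⟩

theorem isSpinFactor_iff_innerProductSpaceable_strongDual {X : Type u} [NormedAddCommGroup X]
    [NormedSpace ℝ X] : IsSpinFactor X ↔ InnerProductSpaceable (StrongDual ℝ X) :=
  isSpinFactor_iff_innerProductSpaceable.trans innerProductSpaceable_strongDual_iff.symm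

end Parallelogram

section PolarForm

variable {V : Type*} [NormedAddCommGroup V] [NormedSpace ℝ V] [InnerProductSpaceable V]

/-- The inner product of a real normed space satisfying the parallelogram law, as a bilinear form.
It is used for dual spaces, which carry no global inner product instance here. -/
noncomputable def polarForm : V →ₗ[ℝ] V →ₗ[ℝ] ℝ :=
  letI := InnerProductSpace.ofNorm ℝ (InnerProductSpaceable.parallelogram_identity (E := V))
  innerₗ V

theorem polarForm_comm (x y : V) : polarForm x y = polarForm y x :=
  letI := InnerProductSpace.ofNorm ℝ (InnerProductSpaceable.parallelogram_identity (E := V))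
  real_inner_comm y x

theorem polarForm_self (x : V) : polarForm x x = ‖x‖ ^ 2 :=
  letI := InnerProductSpace.ofNorm ℝ (InnerProductSpaceable.parallelogram_identity (E := V))
  real_inner_self_eq_norm_sq x

theorem abs_polarForm_le (x y : V) : |polarForm x y| ≤ ‖x‖ * ‖y‖ :=
  letI := InnerProductSpace.ofNorm ℝ (InnerProductSpaceable.parallelogram_identity (E := V))
  abs_real_inner_le_norm x y

theorem polarForm_inv_norm_smul_self (x : V) : polarForm (‖x‖⁻¹ • x) x = ‖x‖ := by
  rw [map_smul, LinearMap.smul_apply, polarForm_self, smul_eq_mul, sq, ← mul_assoc,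
    inv_mul_mul_self]

theorem eq_polarForm_of_forall_abs_le {u : V} (hu : ‖u‖ = 1) {f : V →ₗ[ℝ] ℝ}
    (hf : ∀ z, |f z| ≤ ‖z‖) (hfu : f u = 1) : f = polarForm u := by
  ext z
  have hdiscr : discrim (‖z‖ ^ 2 - f z ^ 2) (2 * (polarForm u z - f z)) 0 ≤ 0 := by
    refine discrim_le_zero fun t => ?_
    have h : f (u + t • z) ^ 2 ≤ ‖u + t • z‖ ^ 2 := sq_le_sq.2 ((hf _).trans (le_abs_self _))
    rw [← polarForm_self] at h
    simp only [map_add, map_smul, LinearMap.add_apply, LinearMap.smul_apply,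
      smul_eq_mul, hfu, polarForm_comm z u, polarForm_self, hu] at h
    linarith
  rw [discrim] at hdiscr
  have : (polarForm u z - f z) ^ 2 = 0 := le_antisymm (by linarith) (sq_nonneg _)
  exact (sub_eq_zero.1 (pow_eq_zero_iff two_ne_zero |>.1 this)).symm

end PolarForm

section Completion

open UniformSpace

variable {E : Type*} [NormedAddCommGroup E] [NormedSpace ℝ E]

theorem norm_comp_toComplL (g : StrongDual ℝ (Completion E)) :
    ‖g.comp Completion.toComplL‖ = ‖g‖ := by
  refine le_antisymm ?_ ?_
  · refine ContinuousLinearMap.opNorm_le_bound _ (norm_nonneg g) fun x => ?_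
    simpa using g.le_opNorm (x : Completion E)
  · refine g.opNorm_le_bound (norm_nonneg _) fun y => ?_
    induction y using Completion.induction_on with
    | hp => exact isClosed_le (by fun_prop) (by fun_prop)
    | ih x => simpa using (g.comp Completion.toComplL).le_opNorm x

variable (E) in
/-- A normed space and its completion have the same dual space, by restriction of functionals. -/
noncomputable def dualCompletionEquiv : StrongDual ℝ (Completion E) ≃ₗᵢ[ℝ] StrongDual ℝ E :=
  let restrict : StrongDual ℝ (Completion E) →ₗᵢ[ℝ] StrongDual ℝ E :=
    { toFun g := g.comp Completion.toComplL
      map_add' _ _ := rfl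
      map_smul' _ _ := rfl
      norm_map' := norm_comp_toComplL }
  LinearIsometryEquiv.ofSurjective restrict fun f => ⟨f.extend Completion.toComplL, by
    ext x
    exact f.extend_eq Completion.denseRange_coe (Completion.isUniformInducing_coe E) x⟩

end Completion

/-! ### Compression bases of order unit spaces -/

namespace OrderUnitSpace

variable {A : Type u} [AddCommGroup A] [Module ℝ A] [PartialOrder A] [OrderUnitSpace A]

instance : IsOrderedAddMonoid A where
  add_le_add_left a b h c := by
    rw [add_comm a c, add_comm b c]
    exact add_le_add_left' a b c h

theorem linearMap_ext_effects {M : Type*} [AddCommGroup M] [Module ℝ M] {f g : A →ₗ[ℝ] M}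
    (h : ∀ e ∈ Set.Icc (0 : A) unit, f e = g e) : f = g := by
  ext a
  obtain ⟨r, hr, hlower, hupper⟩ := exists_bound a
  have hpos : (0 : ℝ) < 2 * r + 1 := by linarith
  have heffect : (2 * r + 1)⁻¹ • (a + r • unit) ∈ Set.Icc (0 : A) unit := by
    refine ⟨smul_nonneg' _ _ (inv_pos.2 hpos).le (neg_le_iff_add_nonneg.1 hlower), ?_⟩
    have hle : a + r • (unit : A) ≤ (2 * r + 1) • unit :=
      calc a + r • (unit : A) ≤ r • unit + r • unit := add_le_add hupper le_rfl
        _ = (2 * r) • (unit : A) := by module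
        _ ≤ (2 * r + 1) • unit := smul_unit_mono (by linarith)
    simpa only [inv_smul_smul₀ hpos.ne'] using smul_le_smul' (inv_pos.2 hpos).le hle
  have hshift := h _ heffect
  rw [map_smul, map_smul] at hshift
  have hadd := smul_right_injective M (inv_pos.2 hpos).ne' hshift
  simpa [h unit ⟨unit_nonneg, le_rfl⟩] using hadd

namespace IsCompression

variable {p q e a b : A} {J K : A →ₗ[ℝ] A}

theorem map_focus (h : IsCompression p J) : J p = p :=
  h.map_eq_self p h.focus_mem le_rfl

theorem map_compl (h : IsCompression p J) : J (unit - p) = 0 := by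
  rw [map_sub, h.map_unit, h.map_focus, sub_self]

theorem mono (h : IsCompression p J) (hab : a ≤ b) : J a ≤ J b := by
  rw [← sub_nonneg, ← map_sub]
  exact h.positive _ (sub_nonneg.2 hab)

theorem map_le_focus (h : IsCompression p J) (ha : a ≤ unit) : J a ≤ p :=
  h.map_unit ▸ h.mono ha

theorem map_mem (h : IsCompression p J) (he : e ∈ Set.Icc 0 unit) : J e ∈ Set.Icc 0 unit :=
  ⟨h.positive e he.1, (h.map_le_focus he.2).trans h.focus_mem.2⟩

theorem eq_zero_of_le (h : IsCompression p J) (he : 0 ≤ e) (hep : e ≤ p) (hep' : e ≤ unit - p) :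
    e = 0 := by
  refine le_antisymm ?_ he
  calc e = J e := (h.map_eq_self e ⟨he, hep.trans h.focus_mem.2⟩ hep).symm
    _ ≤ J (unit - p) := h.mono hep'
    _ = 0 := h.map_compl

theorem comp_eq_zero (hJ : IsCompression p J) (hK : IsCompression q K) (hpq : p + q ≤ unit) :
    J ∘ₗ K = 0 := by
  refine linearMap_ext_effects fun e he => le_antisymm ?_ (hJ.positive _ (hK.positive e he.1))
  calc J (K e) ≤ J (unit - p) :=
        hJ.mono ((hK.map_le_focus he.2).trans (le_sub_iff_add_le'.2 hpq))
    _ = 0 := hJ.map_compl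

theorem comp_eq_right (hJ : IsCompression p J) (hK : IsCompression q K) (hqp : q ≤ p) :
    J ∘ₗ K = K :=
  linearMap_ext_effects fun _ he =>
    hJ.map_eq_self _ (hK.map_mem he) ((hK.map_le_focus he.2).trans hqp)

theorem eq_id (h : IsCompression unit J) : J = LinearMap.id :=
  linearMap_ext_effects fun e he => h.map_eq_self e he he.2

theorem eq_zero (h : IsCompression 0 J) : J = 0 :=
  linearMap_ext_effects fun e he => le_antisymm (h.map_le_focus he.2) (h.positive e he.1)

end IsCompression

theorem isCompression_unit : IsCompression (unit : A) LinearMap.id where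
  positive _ ha := ha
  map_unit := rfl
  focus_mem := ⟨unit_nonneg, le_rfl⟩
  map_eq_self _ _ _ := rfl
  le_of_map_eq_zero := by
    rintro e - rfl
    rw [sub_self]

theorem isCompression_zero : IsCompression (0 : A) 0 where
  positive _ _ := le_rfl
  map_unit := rfl
  focus_mem := ⟨le_rfl, unit_nonneg⟩
  map_eq_self _ he he' := le_antisymm he.1 he'
  le_of_map_eq_zero e he _ := by rw [sub_zero]; exact he.2

namespace CompressionBase

variable {B : CompressionBase A} {p q a : A}

theorem zero_mem : (0 : A) ∈ B.P := by
  simpa using B.compl_mem unit B.unit_mem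

theorem J_unit : B.J unit = LinearMap.id := (B.isCompression _ B.unit_mem).eq_id

theorem J_zero : B.J 0 = 0 := (B.isCompression _ zero_mem).eq_zero

theorem J_J_self (hp : p ∈ B.P) (a : A) : B.J p (B.J p a) = B.J p a :=
  DFunLike.congr_fun ((B.isCompression p hp).comp_eq_right (B.isCompression p hp) le_rfl) a

theorem J_compl_J (hp : p ∈ B.P) (a : A) : B.J (unit - p) (B.J p a) = 0 :=
  DFunLike.congr_fun ((B.isCompression _ (B.compl_mem p hp)).comp_eq_zero (B.isCompression p hp)
    (sub_add_cancel unit p).le) a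

theorem commutes_zero : B.Commutes a 0 := by
  simp [Commutes, J_zero, J_unit]

theorem commutes_unit : B.Commutes a unit := by
  simp [Commutes, J_zero, J_unit]

theorem commutes_J (hp : p ∈ B.P) (a : A) : B.Commutes (B.J p a) p := by
  rw [Commutes, J_J_self hp, J_compl_J hp, add_zero]

theorem Commutes.map_mem (h : B.Commutes p q) (hp : p ∈ B.P) (hq : q ∈ B.P) : B.J q p ∈ B.P := by
  have cq := B.isCompression q hq
  have cq' := B.isCompression _ (B.compl_mem q hq)
  have hpE := (B.isCompression p hp).focus_mem
  have hle : B.J q p ≤ q := cq.map_le_focus hpE.2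
  -- `J_q p` is the common summand of `p = J_q p + J_{1-q} p` and `q = J_q p + (q - J_q p)`.
  refine B.normal _ (cq.map_mem hpE) _ (cq'.map_mem hpE) (q - B.J q p)
    ⟨sub_nonneg.2 hle, (sub_le_self _ (cq.positive p hpE.1)).trans cq.focus_mem.2⟩ ?_ ?_ ?_
  · calc B.J q p + B.J (unit - q) p + (q - B.J q p) = B.J (unit - q) p + q := by abel
      _ ≤ unit := le_sub_iff_add_le.1 (cq'.map_le_focus hpE.2)
  · exact h ▸ hp
  · rwa [add_sub_cancel]

theorem hasComparability_iff : B.HasComparability ↔ ∀ a, ∃ r ∈ B.P,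
    (∀ q ∈ B.P, B.Commutes a q → B.Commutes q r) ∧ B.Commutes a r ∧
      B.J (unit - r) a ≤ 0 ∧ 0 ≤ B.J r a := by
  simp only [HasComparability, bicommutant, PC, Set.mem_ofPred_eq, Set.mem_union,
    Set.mem_singleton_iff, forall_eq, or_imp, forall_and, and_imp, and_assoc]

end CompressionBase

end OrderUnitSpace

/-! ### Generalized spin factors -/

namespace GenSpinFactor

open OrderUnitSpace

variable {X : Type u} [NormedAddCommGroup X] [NormedSpace ℝ X]

/-- The element `(α, y)` of a generalized spin factor. -/
def mk (α : ℝ) (y : StrongDual ℝ X) : GenSpinFactor X := (α, y)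

@[simp] theorem mk_fst (α : ℝ) (y : StrongDual ℝ X) : (mk α y).1 = α := rfl
@[simp] theorem mk_snd (α : ℝ) (y : StrongDual ℝ X) : (mk α y).2 = y := rfl
@[simp] theorem add_fst (a b : GenSpinFactor X) : (a + b).1 = a.1 + b.1 := rfl
@[simp] theorem add_snd (a b : GenSpinFactor X) : (a + b).2 = a.2 + b.2 := rfl
@[simp] theorem sub_fst (a b : GenSpinFactor X) : (a - b).1 = a.1 - b.1 := rfl
@[simp] theorem sub_snd (a b : GenSpinFactor X) : (a - b).2 = a.2 - b.2 := rfl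
@[simp] theorem neg_fst (a : GenSpinFactor X) : (-a).1 = -a.1 := rfl
@[simp] theorem neg_snd (a : GenSpinFactor X) : (-a).2 = -a.2 := rfl
@[simp] theorem zero_fst : (0 : GenSpinFactor X).1 = 0 := rfl
@[simp] theorem zero_snd : (0 : GenSpinFactor X).2 = 0 := rfl
@[simp] theorem smul_fst (r : ℝ) (a : GenSpinFactor X) : (r • a).1 = r * a.1 := rfl
@[simp] theorem smul_snd (r : ℝ) (a : GenSpinFactor X) : (r • a).2 = r • a.2 := rfl
@[simp] theorem unit_fst : (unit : GenSpinFactor X).1 = 1 := rfl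
@[simp] theorem unit_snd : (unit : GenSpinFactor X).2 = 0 := rfl

@[ext] theorem ext {a b : GenSpinFactor X} (h1 : a.1 = b.1) (h2 : a.2 = b.2) : a = b :=
  Prod.ext h1 h2

/-- The projection onto the scalar part, as a linear map. -/
def fstₗ : GenSpinFactor X →ₗ[ℝ] ℝ where
  toFun a := a.1
  map_add' _ _ := rfl
  map_smul' _ _ := rfl

/-- The inclusion of the dual space, as a linear map. -/
def inr : StrongDual ℝ X →ₗ[ℝ] GenSpinFactor X where
  toFun y := mk 0 y
  map_add' _ _ := by ext1 <;> simp
  map_smul' _ _ := by ext1 <;> simp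

@[simp] theorem inr_fst (y : StrongDual ℝ X) : (inr y).1 = 0 := rfl
@[simp] theorem inr_snd (y : StrongDual ℝ X) : (inr y).2 = y := rfl

theorem eq_smul_unit_add_inr (a : GenSpinFactor X) : a = a.1 • unit + inr a.2 := by
  ext1 <;> simp

theorem norm_def (a : GenSpinFactor X) : ‖a‖ = |a.1| + ‖a.2‖ := by
  change orderUnitNorm a = _
  refine le_antisymm (orderUnitNorm_le (by positivity) ?_ ?_) (le_of_forall_gt fun r hr => ?_)
  · simp only [le_def, neg_fst, neg_snd, smul_fst, smul_snd, unit_fst, unit_snd, smul_zero,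
      neg_zero, sub_zero]
    linarith [neg_abs_le a.1]
  · simp only [le_def, smul_fst, smul_snd, unit_fst, unit_snd, smul_zero, zero_sub, norm_neg]
    linarith [le_abs_self a.1]
  · obtain ⟨s, hs, hsr⟩ := exists_between hr
    obtain ⟨hlower, hupper⟩ := bound_of_orderUnitNorm_lt hs
    simp only [le_def, neg_fst, neg_snd, smul_fst, smul_snd, unit_fst, unit_snd, smul_zero,
      neg_zero, sub_zero, zero_sub, norm_neg] at hlower hupper
    rcases abs_cases a.1 with h | h <;> linarith

theorem norm_inr (y : StrongDual ℝ X) : ‖inr y‖ = ‖y‖ := by simp [norm_def]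

theorem fst_nonneg {a : GenSpinFactor X} (ha : 0 ≤ a) : 0 ≤ a.1 :=
  (norm_nonneg _).trans ((nonneg_iff a).1 ha)

theorem eq_zero_of_nonneg {a : GenSpinFactor X} (ha : 0 ≤ a) (h : a.1 = 0) : a = 0 := by
  rw [nonneg_iff, h] at ha
  exact ext h (norm_le_zero_iff.1 ha)

/-! ### The predual -/

/-- The pairing of `ℝ × X*` with `ℝ × X`. -/
noncomputable def pairing : GenSpinFactor X →ₗ[ℝ] StrongDual ℝ (ℝ × X) where
  toFun a := a.1 • ContinuousLinearMap.fst ℝ ℝ X + a.2.comp (ContinuousLinearMap.snd ℝ ℝ X)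
  map_add' a b := by
    ext x <;> simp
  map_smul' r a := by
    ext x <;> simp

theorem pairing_apply (a : GenSpinFactor X) (x : ℝ × X) : pairing a x = a.1 * x.1 + a.2 x.2 :=
  rfl

theorem norm_pairing (a : GenSpinFactor X) : ‖pairing a‖ = ‖a‖ := by
  rw [norm_def]
  apply le_antisymm
  · refine ContinuousLinearMap.opNorm_le_bound _ (by positivity) fun x => ?_
    rw [pairing_apply, add_mul]
    refine (norm_add_le _ _).trans (add_le_add ?_ ?_)
    · rw [norm_mul]
      exact mul_le_mul_of_nonneg_left (norm_fst_le x) (norm_nonneg _)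
    · exact (a.2.le_opNorm _).trans
        (mul_le_mul_of_nonneg_left (norm_snd_le x) (norm_nonneg _))
  · have le_pairing (x : X) (hx : ‖x‖ ≤ 1) : |a.1| + a.2 x ≤ ‖pairing a‖ := by
      obtain ⟨s, hs, hs'⟩ : ∃ s : ℝ, |s| ≤ 1 ∧ a.1 * s = |a.1| := by
        rcases abs_cases a.1 with h | h
        · exact ⟨1, by simp, by rw [h.1, mul_one]⟩
        · exact ⟨-1, by simp, by rw [h.1, mul_neg_one]⟩
      rw [← hs']
      refine (le_abs_self _).trans (((pairing a).le_opNorm (s, x)).trans ?_)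
      exact mul_le_of_le_one_right (norm_nonneg _) (max_le hs hx)
    have hfst : |a.1| ≤ ‖pairing a‖ := by simpa using le_pairing 0 (by simp)
    rw [add_comm, ← le_sub_iff_add_le]
    refine ContinuousLinearMap.opNorm_le_of_unit_norm (sub_nonneg.2 hfst) fun x hx => ?_
    have hneg := le_pairing (-x) (by rw [norm_neg, hx])
    rw [map_neg] at hneg
    exact abs_le.2 ⟨by linarith, by linarith [le_pairing x hx.le]⟩

variable (X) in
/-- A generalized spin factor is the dual of `ℝ × X` with the supremum norm. -/
noncomputable def dualEquiv : GenSpinFactor X ≃ₗᵢ[ℝ] StrongDual ℝ (ℝ × X) :=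
  LinearIsometryEquiv.ofSurjective ⟨pairing, norm_pairing⟩ fun F =>
    ⟨mk (F (1, 0)) (F.comp (ContinuousLinearMap.inr ℝ ℝ X)), by
      ext <;> simp [pairing_apply, Prod.mk_zero_zero]⟩

instance : CompleteSpace (GenSpinFactor X) :=
  (dualEquiv X).toIsometryEquiv.completeSpace

theorem isJBWAlgebra_iff_isJBAlgebra :
    IsJBWAlgebra (GenSpinFactor X) unit ↔ IsJBAlgebra (GenSpinFactor X) unit :=
  and_iff_left ⟨UniformSpace.Completion (ℝ × X), inferInstance, inferInstance, inferInstance,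
    ⟨(dualEquiv X).trans (dualCompletionEquiv (ℝ × X)).symm⟩⟩

/-! ### Atoms and projections -/

/-- The effect `(1/2, u/2)`. For unit vectors `u` these are the projections of `ℝ × X*` other than
`0` and `1`. -/
noncomputable def atom (u : StrongDual ℝ X) : GenSpinFactor X := mk (1 / 2) ((1 / 2 : ℝ) • u)

section Atom

variable {u v : StrongDual ℝ X} {e : GenSpinFactor X}

@[simp] theorem atom_fst (u : StrongDual ℝ X) : (atom u).1 = 1 / 2 := rfl
@[simp] theorem atom_snd (u : StrongDual ℝ X) : (atom u).2 = (1 / 2 : ℝ) • u := rfl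

theorem unit_sub_atom (u : StrongDual ℝ X) : unit - atom u = atom (-u) := by
  ext1
  · norm_num
  · simp

theorem atom_injective : Function.Injective (atom (X := X)) := fun _ _ h =>
  smul_right_injective _ one_half_pos.ne' (congrArg Prod.snd h)

theorem atom_ne_zero (u : StrongDual ℝ X) : atom u ≠ 0 := fun h => by
  simpa using congrArg Prod.fst h

theorem atom_nonneg (hu : ‖u‖ = 1) : 0 ≤ atom u := by
  simp [nonneg_iff, norm_smul, hu]

theorem atom_mem_Icc (hu : ‖u‖ = 1) : atom u ∈ Set.Icc 0 unit := by
  refine ⟨atom_nonneg hu, sub_nonneg.1 ?_⟩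
  rw [unit_sub_atom]
  exact atom_nonneg (by rwa [norm_neg])

theorem not_unit_le_atom (u : StrongDual ℝ X) : ¬unit ≤ atom u := fun h => by
  have := fst_nonneg (sub_nonneg.2 h)
  norm_num at this

theorem atom_le_atom : atom u ≤ atom v ↔ u = v := by
  refine ⟨fun h => ?_, fun h => h ▸ le_rfl⟩
  refine atom_injective (sub_eq_zero.1 (eq_zero_of_nonneg (sub_nonneg.2 h) ?_)).symm
  simp

end Atom

variable (X) in
/-- The elements `0`, `1` and `(1/2, u/2)` with `‖u‖ = 1` of `ℝ × X*`, the possible foci of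
compressions. -/
def projections : Set (GenSpinFactor X) := {p | p = 0 ∨ p = unit ∨ ∃ u, ‖u‖ = 1 ∧ atom u = p}

section Projections

variable {p q : GenSpinFactor X}

theorem zero_mem_projections : 0 ∈ projections X := Or.inl rfl

theorem unit_mem_projections : unit ∈ projections X := Or.inr (Or.inl rfl)

theorem atom_mem_projections {u : StrongDual ℝ X} (hu : ‖u‖ = 1) : atom u ∈ projections X :=
  Or.inr (Or.inr ⟨u, hu, rfl⟩)

theorem compl_mem_projections (hp : p ∈ projections X) : unit - p ∈ projections X := by
  obtain rfl | rfl | ⟨u, hu, rfl⟩ := hp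
  · rw [sub_zero]
    exact unit_mem_projections
  · rw [sub_self]
    exact zero_mem_projections
  · rw [unit_sub_atom]
    exact atom_mem_projections (by rwa [norm_neg])

theorem mem_Icc_of_mem_projections (hp : p ∈ projections X) : p ∈ Set.Icc 0 unit := by
  obtain rfl | rfl | ⟨u, hu, rfl⟩ := hp
  · exact ⟨le_rfl, unit_nonneg⟩
  · exact ⟨unit_nonneg, le_rfl⟩
  · exact atom_mem_Icc hu

theorem eq_zero_or_eq_zero_or_add_eq_unit (hp : p ∈ projections X) (hq : q ∈ projections X)
    (h : p + q ≤ unit) : p = 0 ∨ q = 0 ∨ p + q = unit := by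
  have hp0 := (mem_Icc_of_mem_projections hp).1
  have hq0 := (mem_Icc_of_mem_projections hq).1
  obtain rfl | rfl | ⟨u, -, rfl⟩ := hp
  · exact Or.inl rfl
  · exact Or.inr (Or.inl (le_antisymm ((add_le_iff_nonpos_right _).1 h) hq0))
  obtain rfl | rfl | ⟨v, -, rfl⟩ := hq
  · exact Or.inr (Or.inl rfl)
  · exact Or.inl (le_antisymm (add_le_iff_nonpos_left.1 h) hp0)
  · obtain rfl : u = -v := by
      rwa [← atom_le_atom, ← unit_sub_atom, le_sub_iff_add_le]
    rw [← unit_sub_atom, sub_add_cancel]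
    exact Or.inr (Or.inr rfl)

theorem add_mem_projections (hp : p ∈ projections X) (hq : q ∈ projections X)
    (h : p + q ≤ unit) : p + q ∈ projections X := by
  obtain rfl | rfl | h := eq_zero_or_eq_zero_or_add_eq_unit hp hq h
  · rwa [zero_add]
  · rwa [add_zero]
  · rw [h]
    exact unit_mem_projections

theorem mem_projections_of_idempotent (hfst : p.1 * (1 - p.1) - ‖p.2‖ ^ 2 = 0)
    (hsnd : (1 - 2 * p.1) • p.2 = 0) : p ∈ projections X := by
  rcases smul_eq_zero.1 hsnd with hhalf | hzero
  · have hp : p.1 = 1 / 2 := by linarith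
    have hnorm : ‖p.2‖ = 1 / 2 := by
      rw [← sq_eq_sq₀ (norm_nonneg _) one_half_pos.le]
      rw [hp] at hfst
      linarith
    refine Or.inr (Or.inr ⟨(2 : ℝ) • p.2, by rw [norm_smul, hnorm]; norm_num, ?_⟩)
    ext1
    · exact hp.symm
    · simp [smul_smul]
  · rw [hzero, norm_zero, zero_pow two_ne_zero, sub_zero, mul_eq_zero, sub_eq_zero] at hfst
    rcases hfst with h0 | h1
    · exact Or.inl (ext h0 hzero)
    · exact Or.inr (Or.inl (ext h1.symm hzero))

theorem focus_mem_projections {J : GenSpinFactor X →ₗ[ℝ] GenSpinFactor X}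
    (h : IsCompression p J) : p ∈ projections X := by
  have hp0 : ‖p.2‖ ≤ p.1 := (nonneg_iff p).1 h.focus_mem.1
  have hp1 : ‖p.2‖ ≤ 1 - p.1 := by
    simpa using (nonneg_iff (unit - p)).1 (sub_nonneg.2 h.focus_mem.2)
  -- `e = p - p ∘ p` for the spin product `∘`; it lies below both `p` and `1 - p`.
  set e : GenSpinFactor X := mk (p.1 * (1 - p.1) - ‖p.2‖ ^ 2) ((1 - 2 * p.1) • p.2) with he
  have he_nonneg : 0 ≤ e := by
    rw [nonneg_iff, he, mk_fst, mk_snd, norm_smul, Real.norm_eq_abs]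
    rcases abs_cases (1 - 2 * p.1) with h | h <;> nlinarith [norm_nonneg p.2]
  have he_le : e ≤ p := by
    have hsnd : p.2 - (1 - 2 * p.1) • p.2 = (2 * p.1) • p.2 := by module
    rw [le_def, he, mk_fst, mk_snd, hsnd, norm_smul,
      Real.norm_of_nonneg (by linarith [norm_nonneg p.2])]
    linarith [sq_nonneg (p.1 - ‖p.2‖)]
  have he_le' : e ≤ unit - p := by
    have hsnd : 0 - p.2 - (1 - 2 * p.1) • p.2 = -((2 * (1 - p.1)) • p.2) := by module
    rw [le_def, he, mk_fst, mk_snd, sub_fst, sub_snd, unit_fst, unit_snd, hsnd, norm_neg, norm_smul,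
      Real.norm_of_nonneg (by linarith [norm_nonneg p.2])]
    linarith [sq_nonneg (1 - p.1 - ‖p.2‖)]
  have he0 : e = 0 := h.eq_zero_of_le he_nonneg he_le he_le'
  exact mem_projections_of_idempotent (congrArg Prod.fst he0) (congrArg Prod.snd he0)

end Projections

/-! ### Compression bases with the comparability property -/

section Comparability

variable {B : CompressionBase (GenSpinFactor X)} {u v : StrongDual ℝ X}

theorem mem_projections_of_mem (B : CompressionBase (GenSpinFactor X)) {p : GenSpinFactor X}
    (hp : p ∈ B.P) : p ∈ projections X :=
  focus_mem_projections (B.isCompression p hp)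

theorem eq_or_eq_neg_of_commutes (hu : atom u ∈ B.P) (hv : atom v ∈ B.P)
    (h : B.Commutes (atom u) (atom v)) : u = v ∨ u = -v := by
  have cv := B.isCompression _ hv
  have cu := B.isCompression _ hu
  have hle : B.J (atom v) (atom u) ≤ atom v := cv.map_le_focus cu.focus_mem.2
  obtain h0 | h1 | ⟨w, -, hw⟩ := mem_projections_of_mem B (h.map_mem hu hv)
  · right
    rw [← atom_le_atom, ← unit_sub_atom]
    exact cv.le_of_map_eq_zero _ cu.focus_mem h0
  · rw [h1] at hle
    exact absurd hle (not_unit_le_atom v)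
  · left
    rw [← hw, atom_le_atom] at hle
    rw [hle] at hw
    have hcompl := cv.le_of_map_eq_zero _ (B.isCompression _ (B.compl_mem _ hu)).focus_mem
      (by rw [map_sub, cv.map_unit, ← hw, sub_self])
    rw [unit_sub_atom, unit_sub_atom, atom_le_atom, neg_inj] at hcompl
    exact hcompl

theorem nonneg_or_nonpos_of_J_eq_self (hB : B.HasComparability) (hu : atom u ∈ B.P)
    {b : GenSpinFactor X} (hb : B.J (atom u) b = b) : 0 ≤ b ∨ b ≤ 0 := by
  obtain ⟨r, hr, hcomm, -, hneg, hpos⟩ := CompressionBase.hasComparability_iff.1 hB b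
  have hur := hcomm _ hu (hb ▸ CompressionBase.commutes_J hu b)
  obtain rfl | rfl | ⟨v, -, rfl⟩ := mem_projections_of_mem B hr
  · right
    simpa [CompressionBase.J_unit] using hneg
  · left
    simpa [CompressionBase.J_unit] using hpos
  rcases eq_or_eq_neg_of_commutes hu hr hur with rfl | rfl
  · exact Or.inl (hb ▸ hpos)
  · right
    rwa [unit_sub_atom, hb] at hneg

theorem J_atom_eq (hB : B.HasComparability) (hu : atom u ∈ B.P) (a : GenSpinFactor X) :
    B.J (atom u) a = (2 * (B.J (atom u) a).1) • atom u := by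
  set b := B.J (atom u) a - (2 * (B.J (atom u) a).1) • atom u with hb
  have hfst : b.1 = 0 := by
    rw [hb, sub_fst, smul_fst, atom_fst]
    ring
  have hJ : B.J (atom u) b = b := by
    rw [hb, map_sub, map_smul, CompressionBase.J_J_self hu, (B.isCompression _ hu).map_focus]
  rw [← sub_eq_zero]
  rcases nonneg_or_nonpos_of_J_eq_self hB hu hJ with h | h
  · exact eq_zero_of_nonneg h hfst
  · exact neg_eq_zero.1 (eq_zero_of_nonneg (neg_nonneg.2 h) (by rw [neg_fst, hfst, neg_zero]))

theorem atom_mem_P (hB : B.HasComparability) (hu : ‖u‖ = 1) : atom u ∈ B.P := by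
  have hne : inr u ≠ 0 := fun h => by
    rw [← norm_inr, h, norm_zero] at hu
    exact zero_ne_one hu
  obtain ⟨r, hr, -, hcomm, hneg, hpos⟩ := CompressionBase.hasComparability_iff.1 hB (inr u)
  obtain rfl | rfl | ⟨v, hv, rfl⟩ := mem_projections_of_mem B hr
  · rw [sub_zero, CompressionBase.J_unit, LinearMap.id_apply, ← neg_nonneg] at hneg
    exact absurd (neg_eq_zero.1 (eq_zero_of_nonneg hneg (by simp))) hne
  · rw [CompressionBase.J_unit, LinearMap.id_apply] at hpos
    exact absurd (eq_zero_of_nonneg hpos (by simp)) hne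
  -- `(0, u) = s • atom v + t • atom (-v)`, so `s + t = 0` and `u = s • v` with `0 ≤ s`.
  have hr' := B.compl_mem _ hr
  rw [CompressionBase.Commutes, J_atom_eq hB hr] at hcomm
  rw [unit_sub_atom] at hr' hcomm
  rw [J_atom_eq hB hr'] at hcomm
  set s := 2 * (B.J (atom v) (inr u)).1
  set t := 2 * (B.J (atom (-v)) (inr u)).1
  have hs : 0 ≤ s := mul_nonneg two_pos.le (fst_nonneg hpos)
  have hst : t = -s := by
    have := congrArg Prod.fst hcomm
    simp only [inr_fst, add_fst, smul_fst, atom_fst] at this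
    linarith
  have hus : u = s • v := by
    have := congrArg Prod.snd hcomm
    simp only [inr_snd, add_snd, smul_snd, atom_snd, hst] at this
    rw [this]
    module
  have hs1 : s = 1 := by
    rw [hus, norm_smul, hv, mul_one, Real.norm_of_nonneg hs] at hu
    exact hu
  rwa [hus, hs1, one_smul]

end Comparability

/-! ### Necessity of the parallelogram law -/

/-- The functional `σ` on `X*` with `2 (J (α, y)).1 = α + σ y`, for a compression `J` whose focus is
`(1/2, u/2)` with `‖u‖ = 1`. It is a support functional of the unit ball of `X*` at `u`. -/
noncomputable def supportFunctional (J : GenSpinFactor X →ₗ[ℝ] GenSpinFactor X) :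
    StrongDual ℝ X →ₗ[ℝ] ℝ :=
  (2 : ℝ) • (fstₗ ∘ₗ J ∘ₗ inr)

section SupportFunctional

variable {J : GenSpinFactor X →ₗ[ℝ] GenSpinFactor X} {u : StrongDual ℝ X}

theorem supportFunctional_apply (y : StrongDual ℝ X) : supportFunctional J y = 2 * (J (inr y)).1 :=
  rfl

theorem two_mul_fst_apply (h : IsCompression (atom u) J) (a : GenSpinFactor X) :
    2 * (J a).1 = a.1 + supportFunctional J a.2 := by
  conv_lhs => rw [eq_smul_unit_add_inr a, map_add, map_smul, h.map_unit]
  rw [add_fst, smul_fst, atom_fst, supportFunctional_apply]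
  ring

theorem supportFunctional_self (h : IsCompression (atom u) J) : supportFunctional J u = 1 := by
  have := two_mul_fst_apply h (atom u)
  rw [h.map_focus, atom_fst, atom_snd, map_smul, smul_eq_mul] at this
  linarith

theorem abs_supportFunctional_le (h : IsCompression (atom u) J) (z : StrongDual ℝ X) :
    |supportFunctional J z| ≤ ‖z‖ := by
  have lower (z : StrongDual ℝ X) : 0 ≤ ‖z‖ + supportFunctional J z := by
    have hz : (0 : GenSpinFactor X) ≤ mk ‖z‖ z := (nonneg_iff _).2 le_rfl
    have hJz := fst_nonneg (h.positive _ hz)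
    have := two_mul_fst_apply h (mk ‖z‖ z)
    rw [mk_fst, mk_snd] at this
    linarith
  have upper := lower (-z)
  rw [norm_neg, map_neg] at upper
  exact abs_le.2 ⟨by linarith [lower z], by linarith⟩

end SupportFunctional

theorem innerProductSpaceable_of_jbCondition {B : CompressionBase (GenSpinFactor X)}
    (hB : B.HasComparability) (hJB : B.JBCondition) :
    InnerProductSpaceable (StrongDual ℝ X) := by
  have compression {u : StrongDual ℝ X} (hu : ‖u‖ = 1) : IsCompression (atom u) (B.J (atom u)) :=
    B.isCompression _ (atom_mem_P hB hu)
  have compression_neg {u : StrongDual ℝ X} (hu : ‖u‖ = 1) :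
      IsCompression (atom (-u)) (B.J (atom (-u))) :=
    compression (by rwa [norm_neg])
  let σ (u : StrongDual ℝ X) := supportFunctional (B.J (atom u))
  refine innerProductSpaceable_of_symm_on_sphere (fun u => (1 / 2 : ℝ) • (σ u - σ (-u)))
    (fun u v hu hv => ?_) fun u hu => ?_
  · -- The scalar part of `J_p q + J_{1-p} (1-q)`.
    have fst_eq {u : StrongDual ℝ X} (hu : ‖u‖ = 1) (v : StrongDual ℝ X) :
        4 * (B.J (atom u) (atom v) + B.J (atom (-u)) (atom (-v))).1 = 2 + (σ u v - σ (-u) v) := by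
      have hpos := two_mul_fst_apply (compression hu) (atom v)
      have hneg := two_mul_fst_apply (compression_neg hu) (atom (-v))
      rw [atom_fst, atom_snd, map_smul, smul_eq_mul] at hpos hneg
      rw [map_neg] at hneg
      rw [add_fst]
      linarith
    have hsymm := hJB _ (atom_mem_P hB hu) _ (atom_mem_P hB hv)
    rw [unit_sub_atom, unit_sub_atom] at hsymm
    have huv := fst_eq hu v
    rw [hsymm, fst_eq hv u, add_right_inj] at huv
    simp only [LinearMap.smul_apply, LinearMap.sub_apply, huv]
  · have hneg : σ (-u) (-u) = 1 := supportFunctional_self (compression_neg hu)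
    rw [map_neg] at hneg
    have hpos : σ u u = 1 := supportFunctional_self (compression hu)
    rw [LinearMap.smul_apply, LinearMap.sub_apply, smul_eq_mul]
    linarith

end GenSpinFactor

namespace IsJBProduct

variable {A : Type u} [NormedAddCommGroup A] [NormedSpace ℝ A] {one : A} {mul : A →ₗ[ℝ] A →ₗ[ℝ] A}

theorem mul_one (h : IsJBProduct one mul) (a : A) : mul a one = a := by
  rw [h.comm, h.one_mul]

theorem norm_one_le (h : IsJBProduct one mul) : ‖one‖ ≤ 1 := by
  have hsq := h.norm_sq one
  rw [h.one_mul] at hsq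
  nlinarith [norm_nonneg one]

theorem norm_smul_one_sub_sq_le (h : IsJBProduct one mul) {l : ℝ} (hl : 0 ≤ l) (b : A) :
    ‖l • one - mul b b‖ ^ 2 ≤ l ^ 2 + ‖b‖ ^ 4 := by
  set d := mul b b with hd
  have hsum : mul (l • one - d) (l • one - d) + mul (√(2 * l) • b) (√(2 * l) • b) =
      (l ^ 2) • one + mul d d := by
    simp only [map_sub, map_smul, LinearMap.sub_apply, LinearMap.smul_apply, h.one_mul, h.mul_one,
      smul_smul, Real.mul_self_sqrt (mul_nonneg two_pos.le hl), ← hd]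
    module
  calc ‖l • one - d‖ ^ 2 = ‖mul (l • one - d) (l • one - d)‖ := (h.norm_sq _).symm
    _ ≤ ‖(l ^ 2) • one + mul d d‖ := hsum ▸ h.norm_sq_le _ _
    _ ≤ ‖(l ^ 2) • one‖ + ‖mul d d‖ := norm_add_le _ _
    _ ≤ l ^ 2 + ‖b‖ ^ 4 := by
      rw [h.norm_sq, hd, h.norm_sq, norm_smul, Real.norm_of_nonneg (sq_nonneg l), ← pow_mul]
      gcongr
      exact mul_le_of_le_one_right (sq_nonneg l) h.norm_one_le

end IsJBProduct

namespace GenSpinFactor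

open OrderUnitSpace

variable {X : Type u} [NormedAddCommGroup X] [NormedSpace ℝ X]
  {mul : GenSpinFactor X →ₗ[ℝ] GenSpinFactor X →ₗ[ℝ] GenSpinFactor X}

theorem mul_self_nonneg_of_isJBProduct (h : IsJBProduct unit mul) (b : GenSpinFactor X) :
    0 ≤ mul b b := by
  rw [nonneg_iff]
  by_contra! hlt
  obtain ⟨m, hm, hd⟩ : ∃ m > 0, ‖(mul b b).2‖ = (mul b b).1 + m :=
    ⟨_, sub_pos.2 hlt, (add_sub_cancel _ _).symm⟩
  -- The bound `(l + m)² ≤ l² + ‖b‖⁴` fails for large `l`.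
  set l := ‖b‖ ^ 4 / m
  have hlm : l * m = ‖b‖ ^ 4 := div_mul_cancel₀ _ hm.ne'
  have hl0 : 0 ≤ l := by positivity
  have hle : l + m ≤ ‖l • unit - mul b b‖ := by
    rw [norm_def, sub_fst, sub_snd, smul_fst, smul_snd, unit_fst, unit_snd, smul_zero, zero_sub,
      norm_neg, hd]
    linarith [le_abs_self (l * 1 - (mul b b).1)]
  have hsq : (l + m) ^ 2 ≤ l ^ 2 + ‖b‖ ^ 4 :=
    (pow_le_pow_left₀ (by positivity) hle 2).trans (h.norm_smul_one_sub_sq_le hl0 b)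
  nlinarith [sq_pos_of_pos hm, pow_nonneg (norm_nonneg b) 4]

theorem norm_le_two_mul_fst {a : GenSpinFactor X} (ha : 0 ≤ a) : ‖a‖ ≤ 2 * a.1 := by
  rw [norm_def, abs_of_nonneg (fst_nonneg ha)]
  linarith [(nonneg_iff a).1 ha]

theorem fst_mul_inr_self (h : IsJBProduct unit mul) (y : StrongDual ℝ X) :
    (mul (inr y) (inr y)).1 = ‖y‖ ^ 2 := by
  apply le_antisymm
  · rw [← norm_inr y, ← h.norm_sq, norm_def]
    linarith [le_abs_self (mul (inr y) (inr y)).1, norm_nonneg (mul (inr y) (inr y)).2]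
  · -- Compare norm and scalar part of the square of `c = (‖y‖, y)`, which is positive.
    set c := ‖y‖ • unit + inr y with hc
    have hnorm : ‖mul c c‖ = 4 * ‖y‖ ^ 2 := by
      rw [h.norm_sq, norm_def]
      simp only [hc, add_fst, add_snd, smul_fst, smul_snd, unit_fst, unit_snd, inr_fst, inr_snd,
        smul_zero, zero_add, add_zero, mul_one, abs_norm]
      ring
    have hfst : (mul c c).1 = ‖y‖ ^ 2 + (mul (inr y) (inr y)).1 := by
      simp only [hc, map_add, map_smul, LinearMap.add_apply, LinearMap.smul_apply, h.one_mul,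
        h.mul_one, add_fst, smul_fst, inr_fst, unit_fst]
      ring
    have hle := norm_le_two_mul_fst (mul_self_nonneg_of_isJBProduct h c)
    linarith

theorem innerProductSpaceable_of_isJBProduct (h : IsJBProduct unit mul) :
    InnerProductSpaceable (StrongDual ℝ X) :=
  innerProductSpaceable_of_symm (fun f => fstₗ ∘ₗ mul (inr f) ∘ₗ inr)
    (fun f g => congrArg Prod.fst (h.comm (inr f) (inr g))) (fst_mul_inr_self h)

end GenSpinFactor

/-! ### Quadratic representations -/

section QuadraticRep

variable {A : Type u} [AddCommGroup A] [Module ℝ A]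

/-- The quadratic representation `U_p = 2 L_p² - L_{p²}` of a bilinear product with left
multiplications `L`. -/
noncomputable def quadraticRep (mul : A →ₗ[ℝ] A →ₗ[ℝ] A) (p : A) : A →ₗ[ℝ] A :=
  (2 : ℝ) • (mul p ∘ₗ mul p) - mul (mul p p)

theorem quadraticRep_apply (mul : A →ₗ[ℝ] A →ₗ[ℝ] A) (p a : A) :
    quadraticRep mul p a = (2 : ℝ) • mul p (mul p a) - mul (mul p p) a :=
  rfl

theorem quadraticRep_zero (mul : A →ₗ[ℝ] A →ₗ[ℝ] A) : quadraticRep mul 0 = 0 := by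
  simp [quadraticRep]

end QuadraticRep

namespace IsJBProduct

variable {A : Type u} [NormedAddCommGroup A] [NormedSpace ℝ A] {one : A} {mul : A →ₗ[ℝ] A →ₗ[ℝ] A}

theorem quadraticRep_one (h : IsJBProduct one mul) : quadraticRep mul one = LinearMap.id := by
  ext a
  simp only [quadraticRep_apply, h.one_mul, LinearMap.id_apply]
  module

/-- The right-hand side is symmetric in `p` and `q`, whence the JB condition. -/
theorem quadraticRep_add_quadraticRep_compl (h : IsJBProduct one mul) {p : A}
    (hp : mul p p = p) (q : A) :
    quadraticRep mul p q + quadraticRep mul (one - p) (one - q) =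
      mul p q + mul (one - p) (one - q) := by
  have hp' : mul (one - p) (one - p) = one - p := by
    simp only [map_sub, LinearMap.sub_apply, h.one_mul, h.mul_one, hp, sub_self, sub_zero]
  rw [quadraticRep_apply, quadraticRep_apply, hp, hp']
  simp only [map_sub, LinearMap.sub_apply, h.one_mul, h.mul_one, hp]
  module

theorem quadraticRep_add_quadraticRep_compl_comm (h : IsJBProduct one mul) {p q : A}
    (hp : mul p p = p) (hq : mul q q = q) :
    quadraticRep mul p q + quadraticRep mul (one - p) (one - q) =
      quadraticRep mul q p + quadraticRep mul (one - q) (one - p) := by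
  rw [h.quadraticRep_add_quadraticRep_compl hp, h.quadraticRep_add_quadraticRep_compl hq,
    h.comm p, h.comm (one - p)]

end IsJBProduct

/-! ### Spin factors -/

namespace GenSpinFactor

open OrderUnitSpace

variable {X : Type u} [NormedAddCommGroup X] [NormedSpace ℝ X]
  [InnerProductSpaceable (StrongDual ℝ X)]

/-- The Jordan product of a spin factor. -/
noncomputable def jordanMul : GenSpinFactor X →ₗ[ℝ] GenSpinFactor X →ₗ[ℝ] GenSpinFactor X :=
  LinearMap.mk₂ ℝ (fun a b => mk (a.1 * b.1 + polarForm a.2 b.2) (a.1 • b.2 + b.1 • a.2))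
    (fun a b c => by ext1 <;> simp [add_mul, add_smul, add_add_add_comm])
    (fun r a b => by ext1 <;> simp [mul_add, mul_assoc, mul_smul, smul_comm b.1])
    (fun a b c => by ext1 <;> simp [mul_add, add_smul, add_add_add_comm])
    (fun r a b => by ext1 <;> simp [mul_add, mul_left_comm, mul_smul, smul_comm a.1])

@[simp] theorem jordanMul_fst (a b : GenSpinFactor X) :
    (jordanMul a b).1 = a.1 * b.1 + polarForm a.2 b.2 := rfl

@[simp] theorem jordanMul_snd (a b : GenSpinFactor X) :
    (jordanMul a b).2 = a.1 • b.2 + b.1 • a.2 := rfl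

theorem jordanMul_self_fst (a : GenSpinFactor X) : (jordanMul a a).1 = a.1 ^ 2 + ‖a.2‖ ^ 2 := by
  rw [jordanMul_fst, polarForm_self, sq a.1]

theorem jordanMul_self_snd (a : GenSpinFactor X) : (jordanMul a a).2 = (2 * a.1) • a.2 := by
  rw [jordanMul_snd, two_mul, add_smul]

theorem isJBProduct_jordanMul : IsJBProduct (unit : GenSpinFactor X) jordanMul where
  comm a b := by
    ext1
    · rw [jordanMul_fst, jordanMul_fst, polarForm_comm, mul_comm]
    · rw [jordanMul_snd, jordanMul_snd, add_comm]
  jordan a b := by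
    ext1
    · simp only [jordanMul_fst, jordanMul_snd, map_add, map_smul, LinearMap.add_apply,
        LinearMap.smul_apply, smul_eq_mul, polarForm_comm b.2 a.2]
      ring
    · simp only [jordanMul_fst, jordanMul_snd, map_add, map_smul, LinearMap.add_apply,
        LinearMap.smul_apply, smul_eq_mul, polarForm_comm b.2 a.2]
      module
  one_mul a := by ext1 <;> simp
  norm_mul_le a b := by
    rw [norm_def, norm_def, norm_def, jordanMul_fst, jordanMul_snd]
    calc |a.1 * b.1 + polarForm a.2 b.2| + ‖a.1 • b.2 + b.1 • a.2‖
        ≤ (|a.1 * b.1| + |polarForm a.2 b.2|) + (‖a.1 • b.2‖ + ‖b.1 • a.2‖) :=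
          add_le_add (abs_add_le _ _) (norm_add_le _ _)
      _ ≤ (|a.1| * |b.1| + ‖a.2‖ * ‖b.2‖) + (|a.1| * ‖b.2‖ + |b.1| * ‖a.2‖) := by
          rw [abs_mul, norm_smul, norm_smul, Real.norm_eq_abs, Real.norm_eq_abs]
          gcongr
          exact abs_polarForm_le _ _
      _ = (|a.1| + ‖a.2‖) * (|b.1| + ‖b.2‖) := by ring
  norm_sq a := by
    rw [norm_def, norm_def, jordanMul_self_fst, jordanMul_self_snd, abs_of_nonneg (by positivity),
      norm_smul, Real.norm_eq_abs, abs_mul, abs_two, add_sq, sq_abs]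
    ring
  norm_sq_le a b := by
    have hb : 2 * |b.1| * ‖b.2‖ ≤ b.1 ^ 2 + ‖b.2‖ ^ 2 := sq_abs b.1 ▸ two_mul_le_add_sq _ _
    have hsnd := norm_le_add_norm_add ((2 * a.1) • a.2) ((2 * b.1) • b.2)
    rw [norm_smul (2 * b.1), Real.norm_eq_abs (2 * b.1), abs_mul, abs_two] at hsnd
    rw [norm_def, norm_def, add_fst, add_snd, jordanMul_self_fst, jordanMul_self_fst,
      jordanMul_self_snd, jordanMul_self_snd, abs_of_nonneg (by positivity),
      abs_of_nonneg (by positivity)]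
    linarith

theorem jordanMul_self_of_mem_projections {p : GenSpinFactor X} (hp : p ∈ projections X) :
    jordanMul p p = p := by
  obtain rfl | rfl | ⟨u, hu, rfl⟩ := hp
  · rw [map_zero]
  · exact isJBProduct_jordanMul.one_mul unit
  · ext1
    · rw [jordanMul_self_fst, atom_fst, atom_snd, norm_smul, hu]
      norm_num
    · rw [jordanMul_self_snd, atom_fst, mul_one_div_cancel two_ne_zero, one_smul]

theorem quadraticRep_atom {u : StrongDual ℝ X} (hu : ‖u‖ = 1) (a : GenSpinFactor X) :
    quadraticRep jordanMul (atom u) a = (a.1 + polarForm u a.2) • atom u := by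
  rw [quadraticRep_apply, jordanMul_self_of_mem_projections (atom_mem_projections hu)]
  ext1
  · simp only [sub_fst, smul_fst, jordanMul_fst, jordanMul_snd, atom_fst, atom_snd, map_add,
      map_smul, LinearMap.smul_apply, smul_eq_mul, polarForm_self, hu]
    ring
  · simp only [sub_snd, smul_snd, jordanMul_fst, jordanMul_snd, atom_fst, atom_snd,
      map_smul, LinearMap.smul_apply, smul_eq_mul]
    module

/-! ### The spectral compression base of a spin factor -/

section Effects

variable {u v : StrongDual ℝ X} {e : GenSpinFactor X}

theorem fst_add_polarForm_nonneg (hu : ‖u‖ = 1) (he : 0 ≤ e) : 0 ≤ e.1 + polarForm u e.2 := by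
  have hle := abs_polarForm_le u e.2
  rw [hu, one_mul] at hle
  linarith [(nonneg_iff e).1 he, neg_le_of_abs_le hle]

theorem eq_smul_atom_of_nonneg (hu : ‖u‖ = 1) (he : 0 ≤ e) (h : e.1 = polarForm u e.2) :
    e = (2 * e.1) • atom u := by
  have hnorm : ‖e.2‖ ^ 2 ≤ e.1 ^ 2 := pow_le_pow_left₀ (norm_nonneg _) ((nonneg_iff e).1 he) 2
  have hsq : ‖e.2 - e.1 • u‖ ^ 2 ≤ 0 := by
    rw [← polarForm_self]
    simp only [map_sub, map_smul, LinearMap.sub_apply, LinearMap.smul_apply, smul_eq_mul,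
      polarForm_comm e.2 u, polarForm_self, hu, ← h]
    linarith
  have hsnd : e.2 - e.1 • u = 0 :=
    norm_eq_zero.1 (pow_eq_zero_iff two_ne_zero |>.1 (le_antisymm hsq (sq_nonneg _)))
  ext1
  · rw [smul_fst, atom_fst]
    ring
  · rw [smul_snd, atom_snd, sub_eq_zero.1 hsnd]
    module

theorem eq_smul_atom_of_le (hu : ‖u‖ = 1) (he : 0 ≤ e) (hle : e ≤ atom u) :
    e = (2 * e.1) • atom u := by
  have hneg : ‖-u‖ = 1 := by rwa [norm_neg]
  have hlower := fst_add_polarForm_nonneg hneg he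
  have hupper := fst_add_polarForm_nonneg hneg (sub_nonneg.2 hle)
  simp only [sub_fst, sub_snd, atom_fst, atom_snd, map_sub, map_neg, map_smul,
    LinearMap.neg_apply, smul_eq_mul, polarForm_self, hu] at hlower hupper
  exact eq_smul_atom_of_nonneg hu he (by linarith)

theorem eq_of_le_atom_of_le_atom (hu : ‖u‖ = 1) (hv : ‖v‖ = 1) (he : 0 ≤ e) (he0 : e ≠ 0)
    (heu : e ≤ atom u) (hev : e ≤ atom v) : u = v := by
  have h := (eq_smul_atom_of_le hu he heu).symm.trans (eq_smul_atom_of_le hv he hev)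
  have hne : 2 * e.1 ≠ 0 := mul_ne_zero two_ne_zero fun h0 => he0 (eq_zero_of_nonneg he h0)
  exact atom_injective (smul_right_injective _ hne h)

theorem isCompression_atom (hu : ‖u‖ = 1) :
    IsCompression (atom u) (quadraticRep jordanMul (atom u)) where
  positive a ha := by
    rw [quadraticRep_atom hu]
    exact smul_nonneg' _ _ (fst_add_polarForm_nonneg hu ha) (atom_nonneg hu)
  map_unit := by
    rw [quadraticRep_atom hu, unit_fst, unit_snd, map_zero, add_zero, one_smul]
  focus_mem := atom_mem_Icc hu
  map_eq_self e he hle := by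
    rw [eq_smul_atom_of_le hu he.1 hle, map_smul, quadraticRep_atom hu]
    simp only [atom_fst, atom_snd, map_smul, smul_eq_mul, polarForm_self, hu]
    norm_num
  le_of_map_eq_zero e he h := by
    have hneg : ‖-u‖ = 1 := by rwa [norm_neg]
    have hpolar : e.1 + polarForm u e.2 = 0 := by
      rw [quadraticRep_atom hu] at h
      exact (smul_eq_zero.1 h).resolve_right (atom_ne_zero u)
    have heq : e = (2 * e.1) • atom (-u) := eq_smul_atom_of_nonneg hneg he.1 <| by
      rw [map_neg, LinearMap.neg_apply]
      linarith
    have hnorm : ‖e.2‖ ≤ 1 - e.1 := by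
      simpa using (nonneg_iff (unit - e)).1 (sub_nonneg.2 he.2)
    have hsnd : e.2 = -(e.1 • u) := by
      rw [congrArg Prod.snd heq, smul_snd, atom_snd]
      module
    rw [hsnd, norm_neg, norm_smul, hu, mul_one, Real.norm_of_nonneg (fst_nonneg he.1)] at hnorm
    rw [unit_sub_atom, ← sub_nonneg, heq]
    have hdiff : atom (-u) - (2 * e.1) • atom (-u) = (1 - 2 * e.1) • atom (-u) := by module
    rw [hdiff]
    exact smul_nonneg' _ _ (by linarith) (atom_nonneg hneg)

theorem isCompression_quadraticRep {p : GenSpinFactor X} (hp : p ∈ projections X) :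
    IsCompression p (quadraticRep jordanMul p) := by
  obtain rfl | rfl | ⟨u, hu, rfl⟩ := hp
  · rw [quadraticRep_zero]
    exact isCompression_zero
  · rw [isJBProduct_jordanMul.quadraticRep_one]
    exact isCompression_unit
  · exact isCompression_atom hu

theorem projections_normal {d e f : GenSpinFactor X} (hd : 0 ≤ d) (he : 0 ≤ e) (hf : 0 ≤ f)
    (hdef : d + e + f ≤ unit) (hde : d + e ∈ projections X) (hdf : d + f ∈ projections X) :
    d ∈ projections X := by
  rcases eq_or_ne d 0 with rfl | hd0
  · exact zero_mem_projections
  have heq := hde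
  obtain h0 | h1 | ⟨u, hu, huv⟩ := hde
  · exact absurd (le_antisymm (h0 ▸ le_add_of_nonneg_right he) hd) hd0
  · obtain rfl : f = 0 := le_antisymm (by rwa [h1, add_le_iff_nonpos_right] at hdef) hf
    rwa [add_zero] at hdf
  have hdf' := hdf
  obtain h0 | h1 | ⟨v, hv, hvf⟩ := hdf
  · exact absurd (le_antisymm (h0 ▸ le_add_of_nonneg_right hf) hd) hd0
  · obtain rfl : e = 0 := le_antisymm
      (by rwa [add_right_comm, h1, add_le_iff_nonpos_right] at hdef) he
    rwa [add_zero] at heq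
  obtain rfl : u = v := eq_of_le_atom_of_le_atom hu hv hd hd0
    (huv ▸ le_add_of_nonneg_right he) (hvf ▸ le_add_of_nonneg_right hf)
  -- Now `d + e = d + f` is an atom, and `f` lies below it and below its complement.
  have hf0 : f = 0 := (isCompression_atom hu).eq_zero_of_le hf
    (hvf ▸ le_add_of_nonneg_left hd) (huv ▸ le_sub_iff_add_le'.2 hdef)
  rwa [hf0, add_zero] at hdf'

end Effects

variable (X) in
/-- The compression base of a spin factor given by its quadratic representation. -/
noncomputable def spinBase : CompressionBase (GenSpinFactor X) where
  P := projections X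
  J := quadraticRep jordanMul
  isCompression _ := isCompression_quadraticRep
  unit_mem := unit_mem_projections
  compl_mem _ := compl_mem_projections
  add_mem _ hp _ hq := add_mem_projections hp hq
  normal _ hd _ he _ hf := projections_normal hd.1 he.1 hf.1
  comp p hp q hq r hr h := by
    have hp0 := (mem_Icc_of_mem_projections hp).1
    have hr0 := (mem_Icc_of_mem_projections hr).1
    rw [add_assoc] at h
    have hqr : q + r ≤ unit := (le_add_of_nonneg_left hp0).trans h
    have compression {s : GenSpinFactor X} (hs : s ∈ projections X) := isCompression_quadraticRep hs
    obtain rfl | rfl | h1 := eq_zero_or_eq_zero_or_add_eq_unit hq hr hqr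
    · rw [zero_add] at h ⊢
      exact (compression (add_mem_projections hp hr h)).comp_eq_right (compression hr)
        (le_add_of_nonneg_left hp0)
    · rw [add_zero] at h
      rw [add_zero, add_zero, quadraticRep_zero]
      exact (compression hp).comp_eq_zero (compression hq) h
    · rw [h1, add_le_iff_nonpos_left] at h
      rw [le_antisymm h hp0, h1, zero_add, isJBProduct_jordanMul.quadraticRep_one,
        LinearMap.comp_id]

theorem spinBase_hasProjectionCover : (spinBase X).HasProjectionCover := by
  intro e he
  rcases eq_or_ne e 0 with rfl | he0
  · exact ⟨0, zero_mem_projections, fun q _ => Iff.rfl⟩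
  by_cases hatom : ∃ u, ‖u‖ = 1 ∧ e ≤ atom u
  · obtain ⟨u, hu, heu⟩ := hatom
    refine ⟨atom u, atom_mem_projections hu, fun q hq => ⟨fun heq => ?_, heu.trans⟩⟩
    obtain rfl | rfl | ⟨v, hv, rfl⟩ := hq
    · exact absurd (le_antisymm heq he.1) he0
    · exact (atom_mem_Icc hu).2
    · exact (congrArg atom (eq_of_le_atom_of_le_atom hu hv he.1 he0 heu heq)).le
  · refine ⟨unit, unit_mem_projections, fun q hq => ⟨fun heq => ?_, he.2.trans⟩⟩
    obtain rfl | rfl | ⟨v, hv, rfl⟩ := hq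
    · exact absurd (le_antisymm heq he.1) he0
    · exact le_rfl
    · exact absurd ⟨v, hv, heq⟩ hatom

theorem spinBase_commutes_atom_iff {v : StrongDual ℝ X} (hv : ‖v‖ = 1) {a : GenSpinFactor X} :
    (spinBase X).Commutes a (atom v) ↔ a.2 = polarForm v a.2 • v := by
  have hsum : (spinBase X).J (atom v) a + (spinBase X).J (unit - atom v) a =
      mk a.1 (polarForm v a.2 • v) := by
    change quadraticRep jordanMul (atom v) a + quadraticRep jordanMul (unit - atom v) a = _
    rw [unit_sub_atom, quadraticRep_atom hv, quadraticRep_atom (by rwa [norm_neg])]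
    ext1
    · simp only [add_fst, smul_fst, atom_fst, map_neg, LinearMap.neg_apply, mk_fst]
      ring
    · simp only [add_snd, smul_snd, atom_snd, map_neg, LinearMap.neg_apply, mk_snd]
      module
  rw [CompressionBase.Commutes, hsum]
  exact ⟨fun h => congrArg Prod.snd h, fun h => ext rfl h⟩

theorem spinBase_commutes_of_commutes {u : StrongDual ℝ X} (hu : ‖u‖ = 1) {a q : GenSpinFactor X}
    (ha : a.2 ≠ 0) (hau : (spinBase X).Commutes a (atom u)) (hq : q ∈ projections X)
    (haq : (spinBase X).Commutes a q) : (spinBase X).Commutes q (atom u) := by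
  rw [spinBase_commutes_atom_iff hu] at hau ⊢
  obtain rfl | rfl | ⟨v, hv, rfl⟩ := hq
  · simp
  · simp
  rw [spinBase_commutes_atom_iff hv] at haq
  set c := polarForm v a.2
  have hc : c ≠ 0 := fun h => ha (by rw [haq, h, zero_smul])
  have hvu : v = (c⁻¹ * polarForm u a.2) • u := by
    rw [mul_smul, ← hau, eq_inv_smul_iff₀ hc]
    exact haq.symm
  rw [atom_snd, hvu]
  simp only [map_smul, smul_eq_mul, polarForm_self, hu, one_pow, mul_one, smul_smul]

theorem spinBase_hasComparability : (spinBase X).HasComparability := by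
  rw [CompressionBase.hasComparability_iff]
  intro a
  rcases le_or_gt ‖a.2‖ |a.1| with hle | hlt
  · rcases abs_cases a.1 with ⟨habs, -⟩ | ⟨habs, -⟩
    · refine ⟨unit, unit_mem_projections, fun q _ _ => CompressionBase.commutes_unit,
        CompressionBase.commutes_unit, ?_, ?_⟩
      · rw [sub_self, CompressionBase.J_zero, LinearMap.zero_apply]
      · rw [CompressionBase.J_unit, LinearMap.id_apply, nonneg_iff, ← habs]
        exact hle
    · refine ⟨0, zero_mem_projections, fun q _ _ => CompressionBase.commutes_zero,
        CompressionBase.commutes_zero, ?_, ?_⟩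
      · rw [sub_zero, CompressionBase.J_unit, LinearMap.id_apply, ← neg_nonneg, nonneg_iff, neg_fst,
          neg_snd, norm_neg, ← habs]
        exact hle
      · rw [CompressionBase.J_zero, LinearMap.zero_apply]
  · have ha : a.2 ≠ 0 := norm_pos_iff.1 ((abs_nonneg _).trans_lt hlt)
    obtain ⟨hlower, hupper⟩ := abs_lt.1 hlt
    set u := ‖a.2‖⁻¹ • a.2 with hu_def
    have hu : ‖u‖ = 1 := norm_smul_inv_norm (𝕜 := ℝ) ha
    have hneg : ‖-u‖ = 1 := by rwa [norm_neg]
    have hpolar : polarForm u a.2 = ‖a.2‖ := polarForm_inv_norm_smul_self a.2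
    have hcomm : (spinBase X).Commutes a (atom u) := by
      rw [spinBase_commutes_atom_iff hu, hpolar, hu_def, smul_inv_smul₀ (norm_ne_zero_iff.2 ha)]
    refine ⟨atom u, atom_mem_projections hu, fun q => spinBase_commutes_of_commutes hu ha hcomm,
      hcomm, ?_, ?_⟩
    · change quadraticRep jordanMul (unit - atom u) a ≤ 0
      rw [unit_sub_atom, quadraticRep_atom hneg, map_neg, LinearMap.neg_apply, hpolar,
        ← neg_nonneg, ← neg_smul]
      exact smul_nonneg' _ _ (by linarith) (atom_nonneg hneg)
    · change 0 ≤ quadraticRep jordanMul (atom u) a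
      rw [quadraticRep_atom hu, hpolar]
      exact smul_nonneg' _ _ (by linarith) (atom_nonneg hu)

/-! ### Uniqueness of the compressions -/

theorem J_eq_quadraticRep {B : CompressionBase (GenSpinFactor X)} (hB : B.HasComparability)
    {p : GenSpinFactor X} (hp : p ∈ B.P) : B.J p = quadraticRep jordanMul p := by
  obtain rfl | rfl | ⟨u, hu, rfl⟩ := mem_projections_of_mem B hp
  · rw [CompressionBase.J_zero, quadraticRep_zero]
  · rw [CompressionBase.J_unit, isJBProduct_jordanMul.quadraticRep_one]
  · have h := B.isCompression _ hp
    have hσ : supportFunctional (B.J (atom u)) = polarForm u :=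
      eq_polarForm_of_forall_abs_le hu (abs_supportFunctional_le h) (supportFunctional_self h)
    refine LinearMap.ext fun a => ?_
    rw [J_atom_eq hB hp, two_mul_fst_apply h, hσ, quadraticRep_atom hu]

theorem jbCondition_of_hasComparability {B : CompressionBase (GenSpinFactor X)}
    (hB : B.HasComparability) : B.JBCondition := by
  intro p hp q hq
  rw [J_eq_quadraticRep hB hp, J_eq_quadraticRep hB hq, J_eq_quadraticRep hB (B.compl_mem p hp),
    J_eq_quadraticRep hB (B.compl_mem q hq)]
  exact isJBProduct_jordanMul.quadraticRep_add_quadraticRep_compl_comm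
    (jordanMul_self_of_mem_projections (mem_projections_of_mem B hp))
    (jordanMul_self_of_mem_projections (mem_projections_of_mem B hq))

end GenSpinFactor

theorem theorem5p4_general (X : Type u) [NormedAddCommGroup X] [NormedSpace ℝ X] :
    List.TFAE [
      ∃ B : OrderUnitSpace.CompressionBase (GenSpinFactor X), B.IsSpectral ∧ B.JBCondition,
      (∃ B : OrderUnitSpace.CompressionBase (GenSpinFactor X), B.IsSpectral) ∧
        ∀ B : OrderUnitSpace.CompressionBase (GenSpinFactor X), B.IsSpectral → B.JBCondition,
      IsJBAlgebra (GenSpinFactor X) OrderUnitSpace.unit,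
      IsSpinFactor X,
      IsJBWAlgebra (GenSpinFactor X) OrderUnitSpace.unit] := by
  rw [isSpinFactor_iff_innerProductSpaceable_strongDual]
  tfae_have 2 → 1 := fun ⟨⟨B, hB⟩, hJB⟩ => ⟨B, hB, hJB B hB⟩
  tfae_have 1 → 4 := fun ⟨_, hB, hJB⟩ => GenSpinFactor.innerProductSpaceable_of_jbCondition hB.2 hJB
  tfae_have 3 → 4 := fun ⟨_, _, hmul⟩ => GenSpinFactor.innerProductSpaceable_of_isJBProduct hmul
  tfae_have 4 → 2 := fun _ =>
    ⟨⟨GenSpinFactor.spinBase X, GenSpinFactor.spinBase_hasProjectionCover,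
      GenSpinFactor.spinBase_hasComparability⟩,
      fun _ hB => GenSpinFactor.jbCondition_of_hasComparability hB.2⟩
  tfae_have 4 → 3 := fun _ =>
    ⟨inferInstance, GenSpinFactor.jordanMul, GenSpinFactor.isJBProduct_jordanMul⟩
  tfae_have 5 ↔ 3 := GenSpinFactor.isJBWAlgebra_iff_isJBAlgebra
  tfae_finish

theorem theorem5p4 (X : Type u) [NormedAddCommGroup X] [NormedSpace ℝ X] [CompleteSpace X] :
    List.TFAE [
      ∃ B : OrderUnitSpace.CompressionBase (GenSpinFactor X), B.IsSpectral ∧ B.JBCondition,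
      (∃ B : OrderUnitSpace.CompressionBase (GenSpinFactor X), B.IsSpectral) ∧
        ∀ B : OrderUnitSpace.CompressionBase (GenSpinFactor X), B.IsSpectral → B.JBCondition,
      IsJBAlgebra (GenSpinFactor X) OrderUnitSpace.unit,
      IsSpinFactor X,
      IsJBWAlgebra (GenSpinFactor X) OrderUnitSpace.unit] :=
  theorem5p4_general X
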